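/- **Theorem 1 (Soundness of the dAL proof calculus).** *Syntax.* Let $\mathcal V$ be a countably infinite set of variables, closed under $x\mapsto x'$, all of whose members are independent (freely generated by $'$ from base variables). Terms: $e,g ::= c\in\mathbb Q\mid x\mid e+g\mid e\cdot g\mid (e)'$. Real-arithmetic formulas: $F ::= e\le g\mid\neg F\mid F\wedge G\mid\forall x\,F$. Programs: $\alpha ::= x:=e\mid\ ?Q\mid\{X:F\}\mid\alpha\cup\beta\mid\alpha;\beta\mid\alpha^*$ with $Q,F$ real-arithmetic and $X$ a finite tuple of variables. Formulas: $P ::= e\le g\mid\neg P\mid P\wedge Q\mid\forall x\,P\mid[\alpha]P\mid\alpha\le_X\beta$. Here $=,<,\neq,\to,\leftrightarrow,\exists$ and vector equations are the usual abbreviations, and $X'$ is the tuple of the $x'$ with $x\in X$. *Semantics.* A state is a map $\sigma:\mathcal V\to\mathbb R$; the value of $(e)'$ at $\sigma$ is $\sum_{v\in\mathcal V}\sigma(v')\,\partial e/\partial v(\sigma)$. A trace of duration $T\ge 0$ is a map from $[0,T]$ to states. It is $X$-regular if its $X$-components are $C^1$ on $[0,T]$ (one-sided at the end points, no condition if $T=0$)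 with derivative equal to the $X'$-components, and all variables outside $X\cup X'$ are constant. From $\sigma$, the program $x:=e$ has the single point trace at $\sigma$ with $x$ updated to the value of $e$; $?Q$ has the point trace at $\sigma$ if $\sigma\models Q$ and no trace otherwise; $\{X:F\}$ has all $X$-regular traces that start in $\sigma$ and satisfy $F$ at all times; $\alpha\cup\beta$ has the union; $\alpha;\beta$ has the concatenations $\varphi\cdot\psi$ ($\varphi$ on $[0,T_\varphi)$, then $\psi$ shifted) of a trace $\varphi$ of $\alpha$ from $\sigma$ with a trace $\psi$ of $\beta$ from the final state of $\varphi$; $\alpha^*$ has the finite iterations. $[\alpha]P$ holds in $\sigma$ if $P$ holds in the final state of every trace of $\alpha$ from $\sigma$; $\alpha\le_X\beta$ holds in $\sigma$ if for every trace of $\alpha$ from $\sigma$ there is a trace of $\beta$ from $\sigma$ with the same duration and the same values of $X$ and $X'$ at all times. A formula is valid if it holds in every state, a sequent $\Gamma\vdash\Delta$ if in every state satisfying all of $\Gamma$ some formula of $\Delta$ holds. $FV$ and $BV$ are the usual syntactic free and bound variables, with $BV(\{X:F\})=X\cup X'$, $FV(\{X:F\})=X\cup X'\cup FV(F)$ and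 $FV(\alpha\le_X\beta)=FV(\alpha)\cup FV(\beta)\cup X\cup X'$. *Axioms.* Below, $\preceq$ is $\le$ or $<$, and $J_X(e)=(\partial e_i/\partial x_j)$ and $\det$ are the syntactic Jacobian (of term vectors without the operator $(\cdot)'$) and the syntactic determinant. "$e$ is over $X$" means $FV(e)\subseteq X$. More generally $e$ may also contain parameters $p$ with $p,p'\notin X\cup X'$; then the axiom is prefixed with the hypotheses $p'=0$ for these parameters. "$Z$ is fresh for $X$" means that the variables in $Z,Z'$ are pairwise distinct and not in $X\cup X'$. 1. Differential terms: $(x)'=x'$, $(c)'=0$, $(e+g)'=(e)'+(g)'$, $(e\cdot g)'=(e)'\cdot g+e\cdot(g)'$. 2. Jacobian: $(e)'=J_X(e)\,X'$, for a term vector $e$ over a tuple $X$ of distinct variables. 3. Refinement: $\alpha\le_X\beta\to([\beta]P\to[\alpha]P)$ if $FV(P)\subseteq X\cup(BV(\alpha)\cup BV(\beta))^\complement$; and $\alpha\le_X\beta\to(\beta\le_X\gamma\to\alpha\le_X\gamma)$. 4. Differential weakening: $[\{X:F\}]F$. 5. Differential induction: $e\preceq0\to[\{X:(e)'\le0\}]\,e\preceq0$,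 for $e$ over $X$. 6. Differential hidden constraint: $(e)'=0\to[\{X:e=0\}]\,(e)'=0$, for $e$ over $X$. 7. Algebraic ghost: $[\{X:F\}](e=0\wedge\det J_{X'}(e)\ne0)\to\exists Z\,\exists Z'\,\bigl(\{X:F\}\le_X\{X,Z:F\wedge Z=g\}\bigr)$, where $e$ has as many components as $X$, $Z$ is fresh for $X$, and $Z,Z'$ are not free in $F,g$. 8. Differential ghost: $[\{X:F\}]\det A\ne0\to\forall Z\,\exists Z'\,\bigl(\{X:F\}\le_X\{X,Z:F\wedge AZ'=BZ+c\}\bigr)$, where $Z$ is fresh for $X$ and $Z,Z'$ are not free in $F,A,B,c$. 9. Differential cut: $[\{X:F\}]R\to\{X:F\}\le_X\{X:R\}$ and $[\{X:F\}]R\to\{X:F\}\le_X\{X:F\wedge R\}$. 10. Differential refinement: $\forall Z\,\forall Z'\,\bigl(\{X,Z:R\wedge F\}\le_X\{X:F\}\bigr)$, where $Z,Z'$ are not free in $F$. 11. Differential monotonicity: $\{X:F\}\le_X\{X:G\}\to\{X:F\wedge R\}\le_X\{X:G\wedge R\}$. 12. Differential projection: $[\{X:\exists Y'\exists Y\,F\}]F\wedge[\{X,Y:\exists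 Y'\exists Y\,G\}]G\to\bigl(\{X:F\}\le_X\{X:G\}\to\{X,Y:F\}\le_{X,Y}\{X,Y:G\}\bigr)$. 13. The axioms inherited from dynamic logic: $[\alpha](P\to Q)\to([\alpha]P\to[\alpha]Q)$; $P\to[\alpha]P$ if $FV(P)\cap BV(\alpha)=\emptyset$; $[x:=e]P\leftrightarrow\forall x\,(x=e\to P)$ if $x\notin FV(e)$; $[?Q]P\leftrightarrow(Q\to P)$; $[\alpha\cup\beta]P\leftrightarrow[\alpha]P\wedge[\beta]P$; $[\alpha;\beta]P\leftrightarrow[\alpha][\beta]P$; $[\alpha^*]P\leftrightarrow P\wedge[\alpha][\alpha^*]P$; $[\alpha^*]P\leftrightarrow P\wedge[\alpha^*](P\to[\alpha]P)$; $\forall x\,P\to P$; $\forall x\,P\to[x:=e]P$; reflexivity of $=$ and its congruence for $+$, $\cdot$, $\le$. *Rules.* Use of an axiom; use of a valid real-arithmetic formula without the operator $(\cdot)'$; generalization (from $\vdash P$ infer $\Gamma\vdash[\alpha]P,\Delta$); and the classical first-order sequent rules (identity, weakening/exchange/contraction, cut, $\neg$, $\wedge$, and $\forall$ on the right with the usual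 variable condition). *Claim.* Every axiom is valid; every rule has a valid conclusion whenever its premises are valid; consequently every derivable sequent is valid. -/

import Mathlib

namespace DAL

/-! ### Syntax -/

/-- Variables. The set of variables is closed under `x ↦ x'`: the variable with name `k` and
order `i` is `x_k` carrying `i` primes; all of them are independent of each other. -/
@[ext]
structure Var where
  name : ℕ
  order : ℕ
deriving DecidableEq

/-- The differential variable `x'` of a variable `x`. -/
def Var.prime (x : Var) : Var := ⟨x.name, x.order + 1⟩

/-- Terms `c | x | e + g | e · g | (e)'`. -/
inductive Term where
  | const (c : ℚ)
  | var (x : Var)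
  | add (e g : Term)
  | mul (e g : Term)
  | diff (e : Term)

/-- Formulas of (first-order) real arithmetic. -/
inductive RA where
  | le (e g : Term)
  | neg (F : RA)
  | and (F G : RA)
  | all (x : Var) (F : RA)

/-- Programs `x := e | ?Q | {x : F} | α ∪ β | α ; β | α*`. -/
inductive Prog where
  | assign (x : Var) (e : Term)
  | test (Q : RA)
  | dap (X : List Var) (F : RA)
  | choice (α β : Prog)
  | seq (α β : Prog)
  | loop (α : Prog)

/-- Formulas; `ref X α β` is the partial refinement `α ≤_X β`. -/
inductive Form where
  | le (e g : Term)
  | neg (P : Form)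
  | and (P Q : Form)
  | all (x : Var) (P : Form)
  | box (α : Prog) (P : Form)
  | ref (X : List Var) (α β : Prog)

/-- Real-arithmetic formulas are formulas. -/
def RA.toForm : RA → Form
  | .le e g => .le e g
  | .neg F => .neg F.toForm
  | .and F G => .and F.toForm G.toForm
  | .all x F => .all x F.toForm

/-! Abbreviations. -/

def RA.top : RA := .le (.const 0) (.const 0)
def RA.eq (e g : Term) : RA := .and (.le e g) (.le g e)
def RA.lt (e g : Term) : RA := .neg (.le g e)
def RA.ne (e g : Term) : RA := .neg (RA.eq e g)
def RA.ex (x : Var) (F : RA) : RA := .neg (.all x (.neg F))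

/-- `∃ X F` for a tuple `X`. -/
def RA.exs (X : List Var) (F : RA) : RA := X.foldr RA.ex F

/-- The equation `e = g` between term vectors, i.e. the conjunction of its components. -/
def RA.vecEq {n : ℕ} (e g : Fin n → Term) : RA :=
  (List.ofFn fun i => RA.eq (e i) (g i)).foldr RA.and RA.top

def Form.imp (P Q : Form) : Form := .neg (.and P (.neg Q))
def Form.iff (P Q : Form) : Form := .and (P.imp Q) (Q.imp P)
def Form.ex (x : Var) (P : Form) : Form := .neg (.all x (.neg P))
def Form.alls (X : List Var) (P : Form) : Form := X.foldr Form.all P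
def Form.exs (X : List Var) (P : Form) : Form := X.foldr Form.ex P

/-- `X'` for a tuple `X`. -/
def primes (X : List Var) : List Var := X.map Var.prime

/-- The set of variables `X ∪ X'`. -/
def both (X : List Var) : Finset Var := X.toFinset ∪ (primes X).toFinset

/-- Sum of a vector of terms. -/
def Term.sum {n : ℕ} (f : Fin n → Term) : Term :=
  (List.ofFn f).foldr Term.add (.const 0)

/-- Product of a matrix of terms and a vector of terms. -/
def mulVec {m n : ℕ} (A : Matrix (Fin m) (Fin n) Term) (v : Fin n → Term) : Fin m → Term :=
  fun i => Term.sum fun j => .mul (A i j) (v j)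

/-- The term does not use the differential operator `( · )'`
(differential variables are allowed). -/
def Term.OpFree : Term → Prop
  | .const _ => True
  | .var _ => True
  | .add e g => e.OpFree ∧ g.OpFree
  | .mul e g => e.OpFree ∧ g.OpFree
  | .diff _ => False

def RA.OpFree : RA → Prop
  | .le e g => e.OpFree ∧ g.OpFree
  | .neg F => F.OpFree
  | .and F G => F.OpFree ∧ G.OpFree
  | .all _ F => F.OpFree

/-- Syntactic partial derivative. It is only used on terms without differential operator;
the last clause is a dummy value. -/
def Term.pd (x : Var) : Term → Term
  | .const _ => .const 0
  | .var y => if y = x then .const 1 else .const 0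
  | .add e g => .add (e.pd x) (g.pd x)
  | .mul e g => .add (.mul (e.pd x) g) (.mul e (g.pd x))
  | .diff _ => .const 0

/-- Syntactic Jacobian of the term vector `e` with respect to the tuple `X`. -/
def jac {m n : ℕ} (X : Fin n → Var) (e : Fin m → Term) : Matrix (Fin m) (Fin n) Term :=
  fun i j => (e i).pd (X j)

/-- Syntactic determinant (expansion along the first row). -/
def mdet : {n : ℕ} → Matrix (Fin n) (Fin n) Term → Term
  | 0, _ => .const 1
  | 1, A => A 0 0
  | _ + 2, A => Term.sum fun j =>
      .mul (.mul (.const ((-1) ^ (j : ℕ))) (A 0 j)) (mdet (A.submatrix Fin.succ j.succAbove))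

/-! ### Free and bound variables -/

def Term.fv : Term → Finset Var
  | .const _ => ∅
  | .var x => {x}
  | .add e g => e.fv ∪ g.fv
  | .mul e g => e.fv ∪ g.fv
  | .diff e => e.fv ∪ e.fv.image Var.prime

def RA.fv : RA → Finset Var
  | .le e g => e.fv ∪ g.fv
  | .neg F => F.fv
  | .and F G => F.fv ∪ G.fv
  | .all x F => F.fv.erase x

/-- Bound variables of a program. -/
def Prog.bv : Prog → Finset Var
  | .assign x _ => {x}
  | .test _ => ∅
  | .dap X _ => both X
  | .choice α β => α.bv ∪ β.bv
  | .seq α β => α.bv ∪ β.bv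
  | .loop α => α.bv

/-- Variables that are bound on every run of a program. -/
def Prog.mbv : Prog → Finset Var
  | .assign x _ => {x}
  | .test _ => ∅
  | .dap X _ => both X
  | .choice α β => α.mbv ∩ β.mbv
  | .seq α β => α.mbv ∪ β.mbv
  | .loop _ => ∅

/-- Free variables of a program. A differential-algebraic program reads the initial values of
both `X` and `X'`. -/
def Prog.fv : Prog → Finset Var
  | .assign _ e => e.fv
  | .test Q => Q.fv
  | .dap X F => both X ∪ F.fv
  | .choice α β => α.fv ∪ β.fv
  | .seq α β => α.fv ∪ (β.fv \ α.mbv)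
  | .loop α => α.fv

/-- Free variables of a formula. A refinement `α ≤_X β` compares the values of `X` and `X'` along
whole traces. -/
def Form.fv : Form → Finset Var
  | .le e g => e.fv ∪ g.fv
  | .neg P => P.fv
  | .and P Q => P.fv ∪ Q.fv
  | .all x P => P.fv.erase x
  | .box α P => α.fv ∪ (P.fv \ α.mbv)
  | .ref X α β => α.fv ∪ β.fv ∪ both X

/-! ### Semantics -/

noncomputable section

abbrev State := Var → ℝ

/-- Value of a term. The sum in the last clause ranges over all variables; only those that are free
in `e` contribute. -/
def Term.eval : Term → State → ℝ
  | .const c, _ => (c : ℝ)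
  | .var x, σ => σ x
  | .add e g, σ => e.eval σ + g.eval σ
  | .mul e g, σ => e.eval σ * g.eval σ
  | .diff e, σ =>
      ∑ᶠ v : Var, σ v.prime * deriv (fun r : ℝ => e.eval (Function.update σ v r)) (σ v)

def RA.sat : RA → State → Prop
  | .le e g, σ => e.eval σ ≤ g.eval σ
  | .neg F, σ => ¬ F.sat σ
  | .and F G, σ => F.sat σ ∧ G.sat σ
  | .all x F, σ => ∀ r : ℝ, F.sat (Function.update σ x r)

/-- A trace of duration `dur`: a map from `[0, dur]` to states. -/
structure Trace where
  dur : ℝ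
  dur_nonneg : 0 ≤ dur
  val : Set.Icc (0 : ℝ) dur → State

/-- Extension of a trace to the real line, constant outside `[0, dur]`. -/
def Trace.ext (φ : Trace) : ℝ → State := Set.IccExtend φ.dur_nonneg φ.val

def Trace.initial (φ : Trace) : State := φ.val ⟨0, le_refl 0, φ.dur_nonneg⟩

def Trace.final (φ : Trace) : State := φ.val ⟨φ.dur, φ.dur_nonneg, le_refl φ.dur⟩

/-- The trace of duration `0` at the state `σ`. -/
def Trace.point (σ : State) : Trace := ⟨0, le_refl 0, fun _ => σ⟩

/-- Concatenation: `φ` on `[0, T_φ)` and `ψ(t - T_φ)` on `[T_φ, T_φ + T_ψ]`. -/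
def Trace.concat (φ ψ : Trace) : Trace where
  dur := φ.dur + ψ.dur
  dur_nonneg := add_nonneg φ.dur_nonneg ψ.dur_nonneg
  val := fun t =>
    if h : t.1 < φ.dur then φ.val ⟨t.1, t.2.1, h.le⟩
    else ψ.val ⟨t.1 - φ.dur, sub_nonneg.mpr (not_lt.mp h), sub_le_iff_le_add'.mpr t.2.2⟩

/-- `X`-regular traces: the components in `X` are `C¹` on the closed interval (one-sided derivatives
at the end points) with derivative given by the differential variables, and everything outside
`X ∪ X'` is constant. For duration `0` the first two conditions hold trivially. -/
structure Trace.Regular (X : List Var) (φ : Trace) : Prop where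
  hasDeriv : ∀ x ∈ X, ∀ t ∈ Set.Icc (0 : ℝ) φ.dur,
    HasDerivWithinAt (fun s => φ.ext s x) (φ.ext t x.prime) (Set.Icc 0 φ.dur) t
  contDeriv : ∀ x ∈ X, ContinuousOn (fun s => φ.ext s x.prime) (Set.Icc 0 φ.dur)
  const : ∀ y, y ∉ both X → ∀ t, φ.val t y = φ.initial y

/-- Sequential composition of trace semantics. -/
def seqSem (A B : State → Set Trace) : State → Set Trace := fun σ =>
  {χ | ∃ φ ∈ A σ, ∃ ψ ∈ B φ.final, χ = φ.concat ψ}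

/-- `n`-fold repetition, `α⁰ = ?⊤` and `αⁿ⁺¹ = α ; αⁿ`. -/
def iterSem (A : State → Set Trace) : ℕ → State → Set Trace
  | 0 => fun σ => {Trace.point σ}
  | n + 1 => seqSem A (iterSem A n)

/-- Trace semantics of programs. -/
def Prog.sem : Prog → State → Set Trace
  | .assign x e => fun σ => {Trace.point (Function.update σ x (e.eval σ))}
  | .test Q => fun σ => {φ | φ = Trace.point σ ∧ Q.sat σ}
  | .dap X F => fun σ => {φ | φ.Regular X ∧ φ.initial = σ ∧ ∀ t, F.sat (φ.val t)}
  | .choice α β => fun σ => α.sem σ ∪ β.sem σ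
  | .seq α β => seqSem α.sem β.sem
  | .loop α => fun σ => ⋃ n : ℕ, iterSem α.sem n σ

/-- Two traces coincide on `X`: same duration, same values of the variables in `X` and of their
differential variables at all times. -/
def Coincide (X : List Var) (φ ψ : Trace) : Prop :=
  ∃ h : φ.dur = ψ.dur, ∀ x ∈ both X, ∀ t : Set.Icc (0 : ℝ) φ.dur,
    φ.val t x = ψ.val ⟨t.1, t.2.1, h ▸ t.2.2⟩ x

/-- Semantics of formulas. -/
def Form.sat : Form → State → Prop
  | .le e g, σ => e.eval σ ≤ g.eval σ
  | .neg P, σ => ¬ P.sat σ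
  | .and P Q, σ => P.sat σ ∧ Q.sat σ
  | .all x P, σ => ∀ r : ℝ, P.sat (Function.update σ x r)
  | .box α P, σ => ∀ φ ∈ α.sem σ, P.sat φ.final
  | .ref X α β, σ => ∀ φ ∈ α.sem σ, ∃ ψ ∈ β.sem σ, Coincide X φ ψ

def Form.Valid (P : Form) : Prop := ∀ σ : State, P.sat σ

end

/-! ### The proof calculus -/

/-- `Z` is a tuple of ghost variables for `X`: the variables in `Z, Z'` are pairwise distinct
and do not belong to `X ∪ X'`. -/
def Ghost (Z X : List Var) : Prop :=
  (Z ++ primes Z).Nodup ∧ Disjoint (both Z) (both X)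

/-- `p₁' = 0 → … → pₖ' = 0 → A`; this is `A` itself for the empty tuple. -/
def withParams (P : List Var) (A : Form) : Form :=
  P.foldr (fun p B => (RA.eq (.var p.prime) (.const 0)).toForm.imp B) A

/-- `e` is a term in the variables `X` and the parameters `P`, where the parameters and their
differential variables do not belong to `X ∪ X'`. -/
def TermIn (X P : List Var) (e : Term) : Prop :=
  e.fv ⊆ X.toFinset ∪ P.toFinset ∧ Disjoint (both P) (both X)

/-- The term vector `(x₁, …, xₙ)`. -/
def vars {n : ℕ} (X : Fin n → Var) : Fin n → Term := fun i => .var (X i)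

/-- The term vector `(x₁', …, xₙ')`. -/
def dvars {n : ℕ} (X : Fin n → Var) : Fin n → Term := fun i => .var (X i).prime

/-- The axioms of the calculus. -/
inductive Ax : Form → Prop
  -- differential terms
  | diffVar (x : Var) : Ax (RA.eq (.diff (.var x)) (.var x.prime)).toForm
  | diffConst (c : ℚ) : Ax (RA.eq (.diff (.const c)) (.const 0)).toForm
  | diffAdd (e g : Term) :
      Ax (RA.eq (.diff (.add e g)) (.add (.diff e) (.diff g))).toForm
  | diffMul (e g : Term) :
      Ax (RA.eq (.diff (.mul e g)) (.add (.mul (.diff e) g) (.mul e (.diff g)))).toForm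
  | jacobian {m n : ℕ} (X : Fin n → Var) (P : List Var) (e : Fin m → Term)
      (hX : Function.Injective X) (hop : ∀ i, (e i).OpFree)
      (he : ∀ i, TermIn (List.ofFn X) P (e i)) :
      Ax (withParams P (RA.vecEq (fun i => .diff (e i)) (mulVec (jac X e) (dvars X))).toForm)
  -- refinement
  | refBox (X : List Var) (α β : Prog) (P : Form)
      (h : ∀ v ∈ P.fv, v ∈ X ∨ v ∉ α.bv ∪ β.bv) :
      Ax ((Form.ref X α β).imp ((Form.box β P).imp (.box α P)))
  | refTrans (X : List Var) (α β γ : Prog) :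
      Ax ((Form.ref X α β).imp ((Form.ref X β γ).imp (.ref X α γ)))
  -- differential weakening
  | dW (X : List Var) (F : RA) : Ax (.box (.dap X F) F.toForm)
  -- differential induction, non-strict and strict
  | dIle (X P : List Var) (e : Term) (he : TermIn X P e) :
      Ax (withParams P ((RA.le e (.const 0)).toForm.imp
        (.box (.dap X (.le (.diff e) (.const 0))) (RA.le e (.const 0)).toForm)))
  | dIlt (X P : List Var) (e : Term) (he : TermIn X P e) :
      Ax (withParams P ((RA.lt e (.const 0)).toForm.imp
        (.box (.dap X (.le (.diff e) (.const 0))) (RA.lt e (.const 0)).toForm)))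
  -- differential hidden constraint
  | dHC (X P : List Var) (e : Term) (he : TermIn X P e) :
      Ax (withParams P ((RA.eq (.diff e) (.const 0)).toForm.imp
        (.box (.dap X (RA.eq e (.const 0))) (RA.eq (.diff e) (.const 0)).toForm)))
  -- algebraic ghost
  | aG {n m : ℕ} (X : Fin n → Var) (Z : Fin m → Var) (F : RA) (e : Fin n → Term)
      (g : Fin m → Term) (hop : ∀ i, (e i).OpFree)
      (hZ : Ghost (List.ofFn Z) (List.ofFn X))
      (hF : Disjoint (both (List.ofFn Z)) F.fv)
      (hg : ∀ i, Disjoint (both (List.ofFn Z)) (g i).fv) :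
      Ax ((Form.box (.dap (List.ofFn X) F)
            (RA.and (RA.vecEq e fun _ => .const 0)
              (RA.ne (mdet (jac (fun j => (X j).prime) e)) (.const 0))).toForm).imp
          (Form.exs (List.ofFn Z) (Form.exs (primes (List.ofFn Z))
            (.ref (List.ofFn X) (.dap (List.ofFn X) F)
              (.dap (List.ofFn X ++ List.ofFn Z) (.and F (RA.vecEq (vars Z) g)))))))
  -- differential ghost
  | dG {m : ℕ} (X : List Var) (Z : Fin m → Var) (F : RA)
      (A B : Matrix (Fin m) (Fin m) Term) (c : Fin m → Term)
      (hZ : Ghost (List.ofFn Z) X)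
      (hF : Disjoint (both (List.ofFn Z)) F.fv)
      (hA : ∀ i j, Disjoint (both (List.ofFn Z)) (A i j).fv)
      (hB : ∀ i j, Disjoint (both (List.ofFn Z)) (B i j).fv)
      (hc : ∀ i, Disjoint (both (List.ofFn Z)) (c i).fv) :
      Ax ((Form.box (.dap X F) (RA.ne (mdet A) (.const 0)).toForm).imp
          (Form.alls (List.ofFn Z) (Form.exs (primes (List.ofFn Z))
            (.ref X (.dap X F)
              (.dap (X ++ List.ofFn Z) (.and F
                (RA.vecEq (mulVec A (dvars Z))
                  fun i => .add (mulVec B (vars Z) i) (c i))))))))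
  -- differential cut, with the cut formula as the new constraint or added to the old one
  | dC (X : List Var) (F R : RA) :
      Ax ((Form.box (.dap X F) R.toForm).imp (.ref X (.dap X F) (.dap X R)))
  | dCand (X : List Var) (F R : RA) :
      Ax ((Form.box (.dap X F) R.toForm).imp (.ref X (.dap X F) (.dap X (.and F R))))
  -- differential refinement
  | dR (X Z : List Var) (F R : RA) (hF : Disjoint (both Z) F.fv) :
      Ax (Form.alls Z (Form.alls (primes Z)
        (.ref X (.dap (X ++ Z) (.and R F)) (.dap X F))))
  -- differential monotonicity
  | dM (X : List Var) (F G R : RA) :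
      Ax ((Form.ref X (.dap X F) (.dap X G)).imp
        (.ref X (.dap X (.and F R)) (.dap X (.and G R))))
  -- differential projection
  | dP (X Y : List Var) (F G : RA) :
      Ax ((Form.and (.box (.dap X (RA.exs (primes Y) (RA.exs Y F))) F.toForm)
            (.box (.dap (X ++ Y) (RA.exs (primes Y) (RA.exs Y G))) G.toForm)).imp
          ((Form.ref X (.dap X F) (.dap X G)).imp
            (.ref (X ++ Y) (.dap (X ++ Y) F) (.dap (X ++ Y) G))))
  -- box axioms of dynamic logic
  | boxK (α : Prog) (P Q : Form) :
      Ax ((Form.box α (P.imp Q)).imp ((Form.box α P).imp (.box α Q)))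
  | boxV (α : Prog) (P : Form) (h : Disjoint P.fv α.bv) : Ax (P.imp (.box α P))
  | boxAssign (x : Var) (e : Term) (P : Form) (h : x ∉ e.fv) :
      Ax ((Form.box (.assign x e) P).iff
        (.all x ((RA.eq (.var x) e).toForm.imp P)))
  | boxTest (Q : RA) (P : Form) : Ax ((Form.box (.test Q) P).iff (Q.toForm.imp P))
  | boxChoice (α β : Prog) (P : Form) :
      Ax ((Form.box (.choice α β) P).iff (.and (.box α P) (.box β P)))
  | boxSeq (α β : Prog) (P : Form) :
      Ax ((Form.box (.seq α β) P).iff (.box α (.box β P)))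
  | boxLoop (α : Prog) (P : Form) :
      Ax ((Form.box (.loop α) P).iff (.and P (.box α (.box (.loop α) P))))
  | boxInd (α : Prog) (P : Form) :
      Ax ((Form.box (.loop α) P).iff (.and P (.box (.loop α) (P.imp (.box α P)))))
  -- quantifier instantiation and equality
  | allElim (x : Var) (P : Form) : Ax ((Form.all x P).imp P)
  | allInst (x : Var) (e : Term) (P : Form) : Ax ((Form.all x P).imp (.box (.assign x e) P))
  | eqRefl (e : Term) : Ax (RA.eq e e).toForm
  | leCongr (e e₁ g g₁ : Term) :
      Ax ((RA.eq e e₁).toForm.imp ((RA.eq g g₁).toForm.imp ((Form.le e g).imp (.le e₁ g₁))))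
  | addCongr (e e₁ g g₁ : Term) :
      Ax ((RA.eq e e₁).toForm.imp ((RA.eq g g₁).toForm.imp
        (RA.eq (.add e g) (.add e₁ g₁)).toForm))
  | mulCongr (e e₁ g g₁ : Term) :
      Ax ((RA.eq e e₁).toForm.imp ((RA.eq g g₁).toForm.imp
        (RA.eq (.mul e g) (.mul e₁ g₁)).toForm))

/-- A sequent `Γ ⊢ Δ`. -/
structure Sequent where
  ante : List Form
  succ : List Form

/-- A sequent is valid if in every state in which all formulas of `Γ` hold, some formula
of `Δ` holds. -/
def Sequent.Valid (s : Sequent) : Prop :=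
  ∀ σ : State, (∀ P ∈ s.ante, P.sat σ) → ∃ P ∈ s.succ, P.sat σ

/-- The proof rules: `Rule ps s` says that `s` follows in one step from the premises `ps`. -/
inductive Rule : List Sequent → Sequent → Prop
  | ax (P : Form) (h : Ax P) (Γ Δ : List Form) : Rule [] ⟨Γ, P :: Δ⟩
  -- valid formulas of real arithmetic
  | real (F : RA) (hop : F.OpFree) (h : ∀ σ, F.sat σ) (Γ Δ : List Form) :
      Rule [] ⟨Γ, F.toForm :: Δ⟩
  -- Gödel generalization
  | gen (α : Prog) (P : Form) (Γ Δ : List Form) : Rule [⟨[], [P]⟩] ⟨Γ, .box α P :: Δ⟩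
  -- first-order sequent calculus
  | id (P : Form) (Γ Δ : List Form) : Rule [] ⟨P :: Γ, P :: Δ⟩
  | weaken (Γ Δ Γ₁ Δ₁ : List Form) (hΓ : Γ ⊆ Γ₁) (hΔ : Δ ⊆ Δ₁) : Rule [⟨Γ, Δ⟩] ⟨Γ₁, Δ₁⟩
  | cut (P : Form) (Γ Δ : List Form) : Rule [⟨Γ, P :: Δ⟩, ⟨P :: Γ, Δ⟩] ⟨Γ, Δ⟩
  | negL (P : Form) (Γ Δ : List Form) : Rule [⟨Γ, P :: Δ⟩] ⟨.neg P :: Γ, Δ⟩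
  | negR (P : Form) (Γ Δ : List Form) : Rule [⟨P :: Γ, Δ⟩] ⟨Γ, .neg P :: Δ⟩
  | andL (P Q : Form) (Γ Δ : List Form) : Rule [⟨P :: Q :: Γ, Δ⟩] ⟨.and P Q :: Γ, Δ⟩
  | andR (P Q : Form) (Γ Δ : List Form) :
      Rule [⟨Γ, P :: Δ⟩, ⟨Γ, Q :: Δ⟩] ⟨Γ, .and P Q :: Δ⟩
  | allR (x : Var) (P : Form) (Γ Δ : List Form) (hΓ : ∀ Q ∈ Γ, x ∉ Q.fv)
      (hΔ : ∀ Q ∈ Δ, x ∉ Q.fv) : Rule [⟨Γ, P :: Δ⟩] ⟨Γ, .all x P :: Δ⟩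

/-- Derivability in the calculus. -/
inductive Provable : Sequent → Prop
  | step (ps : List Sequent) (s : Sequent) (h : Rule ps s) (hp : ∀ p ∈ ps, Provable p) :
      Provable s

end DAL

/-!
A term denotes a polynomial function, and along any curve on which `x'` is the derivative of `x`
the value of `(e)'` is the time derivative of the value of `e`. The invariant axioms are then
calculus on `[0, T]`, and the refinement axioms rest on a coincidence property: a program reads only
its free variables and changes only its bound ones.

The ghost axioms extend a solution by new components. For a differential ghost, inverting `A` turns
`A Z' = B Z + c` into a linear equation `Z' = M Z + d` with continuous coefficients, which has a
solution on the whole of `[0, T]`. For an algebraic ghost `Z = g` the point is that `g` may mention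
`X'`, so `X'` has to be differentiable along the given solution: Hadamard's lemma applied to `e = 0`
turns the difference quotients of `X'` into the solution of a linear system whose matrix tends to
the invertible matrix `J_{X'}(e)`.
-/

namespace DAL

open Filter MvPolynomial Set Topology
open scoped Matrix

noncomputable section

section Polynomials

variable {ι κ R 𝕜 : Type*}

theorem eval_mkDerivation [CommRing R] (a : ι → R) (h : ι → MvPolynomial ι R)
    {p : MvPolynomial ι R} {S : Finset ι} (hS : p.vars ⊆ S) :
    eval a (mkDerivation R h p) = ∑ v ∈ S, eval a (h v) * eval a (pderiv v p) := by
  classical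
  let D : Derivation R (MvPolynomial ι R) (MvPolynomial ι R) := ∑ v ∈ S, h v • pderiv v
  have hD (q) : D q = ∑ v ∈ S, h v * pderiv v q :=
    (congrFun (map_sum Derivation.coeFnAddMonoidHom (fun v => h v • pderiv v) S) q).trans
      (Finset.sum_apply _ _ _)
  have heq : mkDerivation R h p = D p := derivation_eq_of_forall_mem_vars fun v hv => by
    simp [hD, mkDerivation_X, pderiv_X, Pi.single_apply, hS hv]
  simp [heq, hD]

theorem exists_hadamard_quotient [CommRing R] {p : MvPolynomial ι R} {S : Finset ι}
    (hS : p.vars ⊆ S) (a : ι → R) :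
    ∃ q : ι → MvPolynomial ι R,
      (∀ b, eval b p - eval a p = ∑ v ∈ S, (b v - a v) * eval b (q v)) ∧
      ∀ v, eval a (q v) = eval a (pderiv v p) := by
  classical
  have hp : p ∈ supported R (S : Set ι) := mem_supported.2 (by exact_mod_cast hS)
  clear hS
  induction hp using Algebra.adjoin_induction with
  | mem x hx =>
    obtain ⟨i, hi, rfl⟩ := hx
    exact ⟨Pi.single i 1, fun b => by simp [Pi.single_apply, apply_ite, Finset.mem_coe.1 hi],
      fun v => by simp [pderiv_X, Pi.single_comm]⟩
  | algebraMap c => exact ⟨0, by simp [algebraMap_eq], by simp [algebraMap_eq]⟩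
  | add p₁ p₂ _ _ ih₁ ih₂ =>
    obtain ⟨q₁, h₁, e₁⟩ := ih₁
    obtain ⟨q₂, h₂, e₂⟩ := ih₂
    refine ⟨q₁ + q₂, fun b => ?_, fun v => by simp [e₁, e₂]⟩
    simp only [Pi.add_apply, map_add, mul_add, Finset.sum_add_distrib, ← h₁, ← h₂]
    ring
  | mul p₁ p₂ _ _ ih₁ ih₂ =>
    obtain ⟨q₁, h₁, e₁⟩ := ih₁
    obtain ⟨q₂, h₂, e₂⟩ := ih₂
    refine ⟨fun v => q₁ v * p₂ + C (eval a p₁) * q₂ v, fun b => ?_, fun v => ?_⟩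
    · calc eval b (p₁ * p₂) - eval a (p₁ * p₂)
          = (eval b p₁ - eval a p₁) * eval b p₂ + eval a p₁ * (eval b p₂ - eval a p₂) := by
            simp only [map_mul]; ring
        _ = _ := by
            rw [h₁, h₂, Finset.sum_mul, Finset.mul_sum, ← Finset.sum_add_distrib]
            refine Finset.sum_congr rfl fun v _ => ?_
            simp only [map_add, map_mul, eval_C]
            ring
    · simp only [map_add, map_mul, eval_C, e₁, e₂, pderiv_mul]

theorem eval_eq_of_eqOn_vars [CommRing R] {p : MvPolynomial ι R} {a b : ι → R}
    (h : EqOn a b p.vars) : eval a p = eval b p := by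
  obtain ⟨q, hq, -⟩ := exists_hadamard_quotient (subset_refl p.vars) b
  rw [← sub_eq_zero, hq]
  exact Finset.sum_eq_zero fun v hv => by rw [h hv, sub_self, zero_mul]

theorem mkDerivation_mem_supported [CommRing R] {h : ι → MvPolynomial ι R} {S T : Set ι}
    (hST : S ⊆ T) (hh : ∀ v ∈ S, h v ∈ supported R T)
    {p : MvPolynomial ι R} (hp : p ∈ supported R S) :
    mkDerivation R h p ∈ supported R T := by
  induction hp using Algebra.adjoin_induction with
  | mem x hx =>
    obtain ⟨v, hv, rfl⟩ := hx
    simpa only [mkDerivation_X] using hh v hv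
  | algebraMap c => simp [zero_mem]
  | add p q _ _ hp hq => simpa only [map_add] using add_mem hp hq
  | mul p q hpS hqS hp hq =>
    simpa only [Derivation.leibniz, smul_eq_mul] using
      add_mem (mul_mem (supported_mono hST hpS) hq) (mul_mem (supported_mono hST hqS) hp)

variable [NontriviallyNormedField 𝕜] {f : 𝕜 → ι → 𝕜} {d : ι → 𝕜} {s : Set 𝕜} {t : 𝕜}

theorem hasDerivWithinAt_eval {p : MvPolynomial ι 𝕜} {S : Finset ι} (hS : p.vars ⊆ S)
    (hf : ContinuousWithinAt f s t)
    (hd : ∀ v ∈ S, HasDerivWithinAt (fun r => f r v) (d v) s t) :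
    HasDerivWithinAt (fun r => eval (f r) p) (∑ v ∈ S, d v * eval (f t) (pderiv v p)) s t := by
  obtain ⟨q, hq, hqt⟩ := exists_hadamard_quotient hS (f t)
  have hslope : slope (fun r => eval (f r) p) t =
      fun r => ∑ v ∈ S, slope (fun r => f r v) t r * eval (f r) (q v) := by
    funext r
    simp only [slope_def_field, hq, Finset.sum_div, div_mul_eq_mul_div]
  rw [hasDerivWithinAt_iff_tendsto_slope, hslope]
  refine tendsto_finsetSum S fun v hv => ?_
  rw [← hqt]
  exact (hasDerivWithinAt_iff_tendsto_slope.1 (hd v hv)).mul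
    (((continuous_eval (q v)).tendsto _).comp (hf.mono sdiff_subset))

theorem deriv_eval_update [DecidableEq ι] (a : ι → 𝕜) (v : ι) (p : MvPolynomial ι 𝕜) :
    deriv (fun r => eval (Function.update a v r) p) (a v) = eval a (pderiv v p) := by
  have hcont : Continuous fun r => Function.update a v r := continuous_const.update v continuous_id
  have h := hasDerivWithinAt_eval (d := Pi.single v 1) (Finset.subset_insert v p.vars)
    hcont.continuousWithinAt fun w _ =>
      (hasDerivAt_pi.1 (hasDerivAt_update a v (a v)) w).hasDerivWithinAt (s := univ)
  rw [hasDerivWithinAt_univ] at h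
  simp [h.deriv, Pi.single_apply]

theorem tendsto_matrix_inv {α n : Type*} [Fintype n] [DecidableEq n] {l : Filter α}
    {A : α → Matrix n n 𝕜} {A₀ : Matrix n n 𝕜} (hA : Tendsto A l (𝓝 A₀)) (hdet : A₀.det ≠ 0) :
    Tendsto (fun r => (A r)⁻¹) l (𝓝 A₀⁻¹) :=
  (continuousAt_matrix_inv A₀ (NormedRing.inverse_continuousAt (Units.mk0 _ hdet))).tendsto.comp hA

theorem tendsto_mulVec {α m n : Type*} [Fintype n] {l : Filter α} {A : α → Matrix m n 𝕜}
    {A₀ : Matrix m n 𝕜} {x : α → n → 𝕜} {x₀ : n → 𝕜} (hA : Tendsto A l (𝓝 A₀))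
    (hx : Tendsto x l (𝓝 x₀)) : Tendsto (fun r => A r *ᵥ x r) l (𝓝 (A₀ *ᵥ x₀)) :=
  tendsto_pi_nhds.2 fun i => tendsto_finsetSum _ fun j _ =>
    (tendsto_pi_nhds.1 (tendsto_pi_nhds.1 hA i) j).mul (tendsto_pi_nhds.1 hx j)

theorem tendsto_of_mulVec_eq {α n : Type*} [Fintype n] [DecidableEq n] {l : Filter α}
    {A : α → Matrix n n 𝕜} {A₀ : Matrix n n 𝕜} {x b : α → n → 𝕜} {b₀ : n → 𝕜}
    (hA : Tendsto A l (𝓝 A₀)) (hdet : A₀.det ≠ 0) (hb : Tendsto b l (𝓝 b₀))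
    (heq : ∀ᶠ r in l, A r *ᵥ x r = b r) : Tendsto x l (𝓝 (A₀⁻¹ *ᵥ b₀)) := by
  have hlim : Tendsto (fun r => (A r)⁻¹ *ᵥ b r) l (𝓝 (A₀⁻¹ *ᵥ b₀)) :=
    tendsto_mulVec (tendsto_matrix_inv hA hdet) hb
  have hunit : ∀ᶠ r in l, (A r).det ≠ 0 :=
    ((continuous_id.matrix_det.tendsto A₀).comp hA).eventually_ne hdet
  refine hlim.congr' ?_
  filter_upwards [heq, hunit] with r hr hdetr
  rw [← hr, Matrix.mulVec_mulVec, Matrix.nonsing_inv_mul _ hdetr.isUnit, Matrix.one_mulVec]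

/-- The Jacobian matrix of the polynomials `p` with respect to the variables `W` at a point. -/
def jacobianAt (p : κ → MvPolynomial ι 𝕜) (W : κ → ι) (a : ι → 𝕜) : Matrix κ κ 𝕜 :=
  Matrix.of fun i j => eval a (pderiv (W j) (p i))

variable [Fintype κ] [DecidableEq κ] {p : κ → MvPolynomial ι 𝕜} {W : κ → ι}

theorem injective_of_det_jacobianAt_ne_zero {a : ι → 𝕜} (h : (jacobianAt p W a).det ≠ 0) :
    Function.Injective W := fun i j hij =>
  by_contra fun hne => h (Matrix.det_zero_of_column_eq hne fun k => by simp [jacobianAt, hij])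

/-- Only the variables in `U` are assumed to be differentiable along `f`; Hadamard's lemma makes the
difference quotients of the variables in `W` the solution of a convergent linear system. -/
theorem hasDerivWithinAt_of_implicit [DecidableEq ι] {U : Finset ι}
    (hvars : ∀ i, (p i).vars ⊆ U ∪ Finset.univ.image W) (hUW : Disjoint U (Finset.univ.image W))
    (hf : ContinuousWithinAt f s t) (ht : t ∈ s) (hp : ∀ r ∈ s, ∀ i, eval (f r) (p i) = 0)
    (hdet : (jacobianAt p W (f t)).det ≠ 0)
    (hd : ∀ v ∈ U, HasDerivWithinAt (fun r => f r v) (d v) s t) :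
    HasDerivWithinAt (fun r j => f r (W j))
      ((jacobianAt p W (f t))⁻¹ *ᵥ fun i => -∑ v ∈ U, d v * eval (f t) (pderiv v (p i))) s t := by
  choose q hq hqt using fun i => exists_hadamard_quotient (hvars i) (f t)
  have hfW : Tendsto f (𝓝[s \ {t}] t) (𝓝 (f t)) := hf.mono sdiff_subset
  have hlim (i v) : Tendsto (fun r => eval (f r) (q i v)) (𝓝[s \ {t}] t)
      (𝓝 (eval (f t) (pderiv v (p i)))) := by
    rw [← hqt]
    exact ((continuous_eval (q i v)).tendsto _).comp hfW
  rw [hasDerivWithinAt_iff_tendsto_slope]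
  refine tendsto_of_mulVec_eq (A := fun r => Matrix.of fun i j => eval (f r) (q i (W j)))
    (b := fun r i => -∑ v ∈ U, slope (fun r => f r v) t r * eval (f r) (q i v))
    (tendsto_pi_nhds.2 fun i => tendsto_pi_nhds.2 fun j => hlim i (W j)) hdet
    (tendsto_pi_nhds.2 fun i => (tendsto_finsetSum U fun v hv =>
      (hasDerivWithinAt_iff_tendsto_slope.1 (hd v hv)).mul (hlim i v)).neg) ?_
  filter_upwards [self_mem_nhdsWithin] with r hr
  funext i
  have hzero := hq i (f r)
  rw [hp r hr.1, hp t ht, sub_self, Finset.sum_union hUW,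
    Finset.sum_image (injective_of_det_jacobianAt_ne_zero hdet).injOn] at hzero
  have hA : (Matrix.of (fun i j => eval (f r) (q i (W j))) *ᵥ slope (fun r j => f r (W j)) t r) i =
      (r - t)⁻¹ * ∑ j, (f r (W j) - f t (W j)) * eval (f r) (q i (W j)) := by
    rw [Finset.mul_sum]
    exact Finset.sum_congr rfl fun j _ => (mul_comm _ _).trans (mul_assoc _ _ _)
  have hb : ∑ v ∈ U, slope (fun r => f r v) t r * eval (f r) (q i v) =
      (r - t)⁻¹ * ∑ v ∈ U, (f r v - f t v) * eval (f r) (q i v) := by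
    rw [Finset.mul_sum]
    exact Finset.sum_congr rfl fun v _ => mul_assoc _ _ _
  rw [hA, hb]
  linear_combination -(r - t)⁻¹ * hzero

end Polynomials

/-! ### Terms as polynomial functions -/

/-- The polynomial in the variables `Var` that a term denotes; the differential of a term denotes
the image of its polynomial under the derivation `x ↦ x'`. -/
def Term.poly : Term → MvPolynomial Var ℝ
  | .const c => C (c : ℝ)
  | .var x => X x
  | .add e g => e.poly + g.poly
  | .mul e g => e.poly * g.poly
  | .diff e => mkDerivation ℝ (fun v : Var => (X v.prime : MvPolynomial Var ℝ)) e.poly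

namespace Term

theorem eval_eq_poly (e : Term) (σ : State) : e.eval σ = MvPolynomial.eval σ e.poly := by
  induction e generalizing σ with
  | const c => simp [Term.eval, poly]
  | var x => simp [Term.eval, poly]
  | add e g he hg => simp [Term.eval, poly, he, hg]
  | mul e g he hg => simp [Term.eval, poly, he, hg]
  | diff e he =>
    simp only [Term.eval, poly, he, deriv_eval_update, eval_mkDerivation σ _ subset_rfl, eval_X]
    refine finsum_eq_sum_of_support_subset _ fun v hv => ?_
    by_contra hn
    exact hv (by simp [pderiv_eq_zero_of_notMem_vars hn])

theorem poly_mem_supported (e : Term) : e.poly ∈ supported ℝ (e.fv : Set Var) := by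
  induction e with
  | const c => exact algebraMap_mem _ _
  | var x => simp [poly, fv, X_mem_supported]
  | add e g he hg =>
    exact add_mem (supported_mono (by simp [fv]) he) (supported_mono (by simp [fv]) hg)
  | mul e g he hg =>
    exact mul_mem (supported_mono (by simp [fv]) he) (supported_mono (by simp [fv]) hg)
  | diff e he =>
    exact mkDerivation_mem_supported (by simp [fv])
      (fun v hv => X_mem_supported.2 (by grind [fv])) he

theorem vars_poly_subset (e : Term) : e.poly.vars ⊆ e.fv := by
  exact_mod_cast mem_supported.1 e.poly_mem_supported

theorem eval_congr (e : Term) {σ τ : State} (h : EqOn σ τ e.fv) : e.eval σ = e.eval τ := by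
  simpa only [eval_eq_poly] using
    eval_eq_of_eqOn_vars (h.mono (Finset.coe_subset.2 e.vars_poly_subset))

theorem continuous_eval (e : Term) : Continuous e.eval := by
  simpa only [funext e.eval_eq_poly] using MvPolynomial.continuous_eval e.poly

theorem eval_diff (e : Term) (σ : State) {S : Finset Var} (hS : e.fv ⊆ S) :
    (diff e).eval σ = ∑ v ∈ S, σ v.prime * MvPolynomial.eval σ (pderiv v e.poly) := by
  simpa only [eval_eq_poly, poly, eval_X] using
    eval_mkDerivation σ (fun v => X v.prime) (e.vars_poly_subset.trans hS)

theorem hasDerivWithinAt_eval_of_prime (e : Term) {f : ℝ → State} {s : Set ℝ} {t : ℝ}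
    (hf : ContinuousWithinAt f s t)
    (hd : ∀ v ∈ e.fv, HasDerivWithinAt (fun r => f r v) (f t v.prime) s t) :
    HasDerivWithinAt (fun r => e.eval (f r)) ((diff e).eval (f t)) s t := by
  simpa only [eval_diff e _ subset_rfl, eval_eq_poly] using
    hasDerivWithinAt_eval e.vars_poly_subset hf hd

theorem eval_pd {e : Term} (he : e.OpFree) (v : Var) (σ : State) :
    (e.pd v).eval σ = MvPolynomial.eval σ (pderiv v e.poly) := by
  induction e with
  | const c => simp [pd, Term.eval, poly]
  | var x => by_cases h : x = v <;> simp [pd, Term.eval, poly, h]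
  | add e g ihe ihg => simp [pd, Term.eval, poly, ihe he.1, ihg he.2]
  | mul e g ihe ihg =>
    simp only [pd, Term.eval, ihe he.1, ihg he.2]
    simp only [poly, eval_eq_poly, pderiv_mul, map_add, map_mul]
  | diff e => exact he.elim

theorem eval_sum {n : ℕ} (f : Fin n → Term) (σ : State) : (sum f).eval σ = ∑ i, (f i).eval σ := by
  induction n with
  | zero => simp [sum, Term.eval]
  | succ n ih =>
    rw [Fin.sum_univ_succ, ← ih fun i => f i.succ]
    simp [sum, List.ofFn_succ, Term.eval]

end Term

theorem eval_mulVec {m n : ℕ} (A : Matrix (Fin m) (Fin n) Term) (v : Fin n → Term) (i : Fin m)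
    (σ : State) : (mulVec A v i).eval σ = ∑ j, (A i j).eval σ * (v j).eval σ := by
  simp [mulVec, Term.eval_sum, Term.eval]

/-- The matrix of values of a matrix of terms. -/
def evalMat {m n : ℕ} (A : Matrix (Fin m) (Fin n) Term) (σ : State) : Matrix (Fin m) (Fin n) ℝ :=
  Matrix.of fun i j => (A i j).eval σ

theorem eval_mdet {n : ℕ} (A : Matrix (Fin n) (Fin n) Term) (σ : State) :
    (mdet A).eval σ = (evalMat A σ).det := by
  induction n using Nat.twoStepInduction with
  | zero => simp [mdet, Term.eval]
  | one => simp [mdet, evalMat]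
  | more n _ ih =>
    rw [mdet, Term.eval_sum, Matrix.det_succ_row_zero]
    refine Finset.sum_congr rfl fun j _ => ?_
    simp only [Term.eval, ih]
    push_cast
    rfl

theorem continuous_evalMat {m n : ℕ} (A : Matrix (Fin m) (Fin n) Term) : Continuous (evalMat A) :=
  continuous_matrix fun i j => (A i j).continuous_eval

theorem evalMat_jac_eq_jacobianAt {n : ℕ} {e : Fin n → Term} (he : ∀ i, (e i).OpFree)
    (W : Fin n → Var) (σ : State) : evalMat (jac W e) σ = jacobianAt (fun i => (e i).poly) W σ :=
  Matrix.ext fun i j => Term.eval_pd (he i) (W j) σ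

/-! ### Satisfaction of the abbreviations -/

theorem eqOn_update_of_eqOn_erase {σ τ : State} {S : Finset Var} {x : Var}
    (h : EqOn σ τ (S.erase x)) (r : ℝ) :
    EqOn (Function.update σ x r) (Function.update τ x r) S := fun v hv => by
  by_cases hvx : v = x
  · subst hvx; simp
  · simpa [hvx] using h (Finset.mem_erase.2 ⟨hvx, hv⟩)

namespace RA

@[simp] theorem sat_toForm (F : RA) (σ : State) : F.toForm.sat σ ↔ F.sat σ := by
  induction F generalizing σ with
  | le e g => rfl
  | neg F ih => exact not_congr (ih σ)
  | and F G ihF ihG => exact and_congr (ihF σ) (ihG σ)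
  | all x F ih => exact forall_congr' fun r => ih _

theorem sat_congr {F : RA} {σ τ : State} (h : EqOn σ τ F.fv) : F.sat σ ↔ F.sat τ := by
  induction F generalizing σ τ with
  | le e g =>
    simp only [sat, e.eval_congr (h.mono (by simp [fv])), g.eval_congr (h.mono (by simp [fv]))]
  | neg F ih => exact not_congr (ih h)
  | and F G ihF ihG =>
    exact and_congr (ihF (h.mono (by simp [fv]))) (ihG (h.mono (by simp [fv])))
  | all x F ih => exact forall_congr' fun r => ih (eqOn_update_of_eqOn_erase h r)

@[simp] theorem sat_eq (e g : Term) (σ : State) : (eq e g).sat σ ↔ e.eval σ = g.eval σ :=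
  le_antisymm_iff.symm

@[simp] theorem sat_lt (e g : Term) (σ : State) : (lt e g).sat σ ↔ e.eval σ < g.eval σ :=
  not_le

@[simp] theorem sat_ne (e g : Term) (σ : State) : (ne e g).sat σ ↔ e.eval σ ≠ g.eval σ :=
  not_congr (sat_eq e g σ)

@[simp] theorem sat_vecEq {n : ℕ} (e g : Fin n → Term) (σ : State) :
    (vecEq e g).sat σ ↔ ∀ i, (e i).eval σ = (g i).eval σ := by
  induction n with
  | zero => simp [vecEq, top, sat]
  | succ n ih =>
    rw [Fin.forall_fin_succ, ← ih, ← sat_eq]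
    simp only [vecEq, List.ofFn_succ, List.foldr_cons, sat]

theorem toForm_exs (L : List Var) (F : RA) : (exs L F).toForm = Form.exs L F.toForm := by
  induction L with
  | nil => rfl
  | cons x L ih => exact congrArg (Form.ex x) ih

end RA

namespace Form

@[simp] theorem sat_and (P Q : Form) (σ : State) : (and P Q).sat σ ↔ P.sat σ ∧ Q.sat σ :=
  Iff.rfl

@[simp] theorem sat_imp (P Q : Form) (σ : State) : (P.imp Q).sat σ ↔ (P.sat σ → Q.sat σ) := by
  simp [imp, sat]

@[simp] theorem sat_iff (P Q : Form) (σ : State) : (P.iff Q).sat σ ↔ (P.sat σ ↔ Q.sat σ) := by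
  simp only [iff, sat, sat_imp]
  exact iff_iff_implies_and_implies.symm

theorem sat_alls (L : List Var) (P : Form) (σ : State) :
    (alls L P).sat σ ↔ ∀ ρ : State, (∀ v ∉ L, ρ v = σ v) → P.sat ρ := by
  induction L generalizing σ with
  | nil => exact ⟨fun h ρ hρ => (funext fun v => hρ v (by simp) : ρ = σ) ▸ h,
      fun h => h σ fun _ _ => rfl⟩
  | cons x L ih =>
    refine (forall_congr' fun r => ih (Function.update σ x r)).trans
      ⟨fun h ρ hρ => h (ρ x) ρ fun v hv => ?_, fun h r ρ hρ => h ρ fun v hv => ?_⟩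
    · by_cases hvx : v = x
      · subst hvx; simp
      · simpa [hvx] using hρ v (by simp [hvx, hv])
    · rw [hρ v (by simp_all), Function.update_of_ne (by simp_all)]

theorem sat_exs (L : List Var) (P : Form) (σ : State) :
    (exs L P).sat σ ↔ ∃ ρ : State, (∀ v ∉ L, ρ v = σ v) ∧ P.sat ρ := by
  have hdual : ∀ σ, (exs L P).sat σ ↔ ¬ (alls L (.neg P)).sat σ := by
    induction L with
    | nil => exact fun σ => not_not.symm
    | cons x L ih => exact fun σ => not_congr (forall_congr' fun r => not_iff_comm.1 (ih _).symm)
  rw [hdual, sat_alls]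
  simp [sat]

end Form

theorem RA.sat_exs (L : List Var) (F : RA) (σ : State) :
    (exs L F).sat σ ↔ ∃ ρ : State, (∀ v ∉ L, ρ v = σ v) ∧ F.sat ρ := by
  simp only [← sat_toForm, toForm_exs, Form.sat_exs]

@[simp] theorem sat_withParams (P : List Var) (A : Form) (σ : State) :
    (withParams P A).sat σ ↔ ((∀ p ∈ P, σ p.prime = 0) → A.sat σ) := by
  induction P with
  | nil => simp [withParams]
  | cons p P ih =>
    rw [List.forall_mem_cons, and_imp, ← ih]
    simp [withParams, RA.sat_toForm, Term.eval]

/-! ### Traces -/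

namespace Trace

/-- The trace of duration `T` given by a function on the real line. -/
def ofFun (T : ℝ) (hT : 0 ≤ T) (f : ℝ → State) : Trace := ⟨T, hT, fun t => f t.1⟩

theorem ext_of_mem (φ : Trace) {t : ℝ} (ht : t ∈ Icc 0 φ.dur) : φ.ext t = φ.val ⟨t, ht⟩ :=
  IccExtend_of_mem _ _ ht

theorem initial_eq_ext (φ : Trace) : φ.initial = φ.ext 0 :=
  (φ.ext_of_mem ⟨le_rfl, φ.dur_nonneg⟩).symm

theorem final_eq_ext (φ : Trace) : φ.final = φ.ext φ.dur :=
  (φ.ext_of_mem ⟨φ.dur_nonneg, le_rfl⟩).symm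

theorem ext_ofFun {T : ℝ} (hT : 0 ≤ T) (f : ℝ → State) {t : ℝ} (ht : t ∈ Icc 0 T) :
    (ofFun T hT f).ext t = f t :=
  ext_of_mem (ofFun T hT f) ht

theorem ext_concat (φ ψ : Trace) {t : ℝ} (ht : t ∈ Icc 0 (φ.dur + ψ.dur)) :
    (φ.concat ψ).ext t = if t < φ.dur then φ.ext t else ψ.ext (t - φ.dur) := by
  rw [ext_of_mem (φ.concat ψ) ht]
  simp only [concat]
  split_ifs with h
  · exact (φ.ext_of_mem _).symm
  · exact (ψ.ext_of_mem _).symm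

@[simp] theorem final_concat (φ ψ : Trace) : (φ.concat ψ).final = ψ.final := by
  have hend := φ.ext_concat ψ ⟨add_nonneg φ.dur_nonneg ψ.dur_nonneg, le_rfl⟩
  rw [if_neg (by linarith [ψ.dur_nonneg]), add_sub_cancel_left, ← ψ.final_eq_ext] at hend
  rw [final_eq_ext, ← hend]
  rfl

/-- Two traces have the same duration and, at all times, the same values of the variables
in `V`. -/
def AgreeOn (V : Finset Var) (φ ψ : Trace) : Prop :=
  φ.dur = ψ.dur ∧ ∀ t ∈ Icc 0 φ.dur, EqOn (φ.ext t) (ψ.ext t) V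

variable {V W : Finset Var} {φ ψ χ φ' ψ' : Trace}

theorem AgreeOn.mono (h : φ.AgreeOn V ψ) (hW : W ⊆ V) : φ.AgreeOn W ψ :=
  ⟨h.1, fun t ht => (h.2 t ht).mono (Finset.coe_subset.2 hW)⟩

theorem AgreeOn.trans (h : φ.AgreeOn V ψ) (h' : ψ.AgreeOn V χ) : φ.AgreeOn V χ :=
  ⟨h.1.trans h'.1, fun t ht => (h.2 t ht).trans (h'.2 t (h.1 ▸ ht))⟩

theorem AgreeOn.final (h : φ.AgreeOn V ψ) : EqOn φ.final ψ.final V := by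
  rw [φ.final_eq_ext, ψ.final_eq_ext, ← h.1]
  exact h.2 _ ⟨φ.dur_nonneg, le_rfl⟩

theorem AgreeOn.concat (h : φ.AgreeOn V φ') (h' : ψ.AgreeOn V ψ') :
    (φ.concat ψ).AgreeOn V (φ'.concat ψ') := by
  have hdur : φ.dur + ψ.dur = φ'.dur + ψ'.dur := by rw [h.1, h'.1]
  refine ⟨hdur, fun t (ht : t ∈ Icc 0 (φ.dur + ψ.dur)) => ?_⟩
  rw [φ.ext_concat ψ ht, φ'.ext_concat ψ' (hdur ▸ ht), ← h.1]
  split_ifs with hlt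
  · exact h.2 t ⟨ht.1, hlt.le⟩
  · exact h'.2 _ ⟨sub_nonneg.2 (not_lt.1 hlt), sub_le_iff_le_add'.2 ht.2⟩

theorem agreeOn_point {σ τ : State} (h : EqOn σ τ V) : (point σ).AgreeOn V (point τ) :=
  ⟨rfl, fun _ _ => h⟩

theorem coincide_iff_agreeOn {X : List Var} : Coincide X φ ψ ↔ φ.AgreeOn (both X) ψ := by
  constructor
  · rintro ⟨h, hX⟩
    refine ⟨h, fun t ht v hv => ?_⟩
    rw [φ.ext_of_mem ht, ψ.ext_of_mem (h ▸ ht)]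
    exact hX v hv ⟨t, ht⟩
  · rintro ⟨h, hX⟩
    refine ⟨h, fun v hv t => ?_⟩
    rw [← φ.ext_of_mem t.2, ← ψ.ext_of_mem (h ▸ t.2)]
    exact hX t.1 t.2 hv

end Trace

/-! ### Solutions of differential-algebraic programs -/

/-- The function `f` describes on `[0, T]` a trace of `{X : F}` from the state `σ`. Working with
functions on the real line keeps the domain fixed when a trace is restricted or modified. -/
structure IsSolution (X : List Var) (F : RA) (σ : State) (T : ℝ) (f : ℝ → State) : Prop where
  nonneg : 0 ≤ T
  init : f 0 = σ
  hasDeriv : ∀ x ∈ X, ∀ t ∈ Icc 0 T,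
    HasDerivWithinAt (fun s => f s x) (f t x.prime) (Icc 0 T) t
  contDeriv : ∀ x ∈ X, ContinuousOn (fun s => f s x.prime) (Icc 0 T)
  const : ∀ y ∉ both X, ∀ t ∈ Icc 0 T, f t y = σ y
  sat : ∀ t ∈ Icc 0 T, F.sat (f t)

theorem mem_both {X : List Var} {v : Var} : v ∈ both X ↔ v ∈ X ∨ ∃ x ∈ X, x.prime = v := by
  simp [both, primes]

theorem mem_both_of_mem {X : List Var} {x : Var} (hx : x ∈ X) : x ∈ both X :=
  mem_both.2 (.inl hx)

theorem prime_mem_both_of_mem {X : List Var} {x : Var} (hx : x ∈ X) : x.prime ∈ both X :=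
  mem_both.2 (.inr ⟨x, hx, rfl⟩)

theorem both_append (X Z : List Var) : both (X ++ Z) = both X ∪ both Z := by
  ext v
  simp only [mem_both, Finset.mem_union, List.mem_append]
  grind

namespace IsSolution

variable {X Y : List Var} {F G : RA} {σ τ : State} {T : ℝ} {f : ℝ → State}

theorem of_mem_sem {φ : Trace} (h : φ ∈ (Prog.dap X F).sem σ) : IsSolution X F σ φ.dur φ.ext where
  nonneg := φ.dur_nonneg
  init := by rw [← φ.initial_eq_ext, h.2.1]
  hasDeriv := h.1.hasDeriv
  contDeriv := h.1.contDeriv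
  const y hy t ht := by rw [φ.ext_of_mem ht, h.1.const y hy, h.2.1]
  sat t ht := by rw [φ.ext_of_mem ht]; exact h.2.2 _

theorem ofFun_mem_sem (h : IsSolution X F σ T f) :
    Trace.ofFun T h.nonneg f ∈ (Prog.dap X F).sem σ := by
  have hext : ∀ t ∈ Icc 0 T, (Trace.ofFun T h.nonneg f).ext t = f t := fun t ht =>
    Trace.ext_ofFun h.nonneg f ht
  refine ⟨⟨fun x hx t ht => ?_, fun x hx => ?_, fun y hy t => ?_⟩, h.init, fun t => h.sat t.1 t.2⟩
  · rw [hext t ht]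
    exact (h.hasDeriv x hx t ht).congr_of_mem (fun s hs => congrFun (hext s hs) x) ht
  · exact (h.contDeriv x hx).congr fun s hs => congrFun (hext s hs) x.prime
  · exact (h.const y hy t.1 t.2).trans (congrFun h.init y).symm

theorem restrict {t : ℝ} (h : IsSolution X F σ T f) (ht : t ∈ Icc 0 T) : IsSolution X F σ t f := by
  have hsub : Icc 0 t ⊆ Icc 0 T := Icc_subset_Icc_right ht.2
  exact ⟨ht.1, h.init, fun x hx s hs => (h.hasDeriv x hx s (hsub hs)).mono hsub,
    fun x hx => (h.contDeriv x hx).mono hsub, fun y hy s hs => h.const y hy s (hsub hs),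
    fun s hs => h.sat s (hsub hs)⟩

theorem withSat (h : IsSolution X F σ T f) (hG : ∀ t ∈ Icc 0 T, G.sat (f t)) :
    IsSolution X G σ T f :=
  { h with sat := hG }

theorem hasDeriv_of_notMem (h : IsSolution X F σ T f) {y : Var} (hy : y ∉ both X) {t : ℝ}
    (ht : t ∈ Icc 0 T) : HasDerivWithinAt (fun s => f s y) 0 (Icc 0 T) t :=
  (hasDerivWithinAt_const t _ (σ y)).congr_of_mem (fun s hs => h.const y hy s hs) ht

theorem continuousOn (h : IsSolution X F σ T f) : ContinuousOn f (Icc 0 T) := by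
  refine continuousOn_pi.2 fun v => ?_
  by_cases hv : v ∈ both X
  · rcases mem_both.1 hv with hx | ⟨x, hx, rfl⟩
    · exact fun t ht => (h.hasDeriv v hx t ht).continuousWithinAt
    · exact h.contDeriv x hx
  · exact fun t ht => (h.hasDeriv_of_notMem hv ht).continuousWithinAt

theorem piecewise (h : IsSolution Y F σ T f) (hXY : X ⊆ Y) (hτ : EqOn σ τ (both X))
    (hG : ∀ t ∈ Icc 0 T, G.sat ((both X).piecewise (f t) τ)) :
    IsSolution X G τ T fun t => (both X).piecewise (f t) τ where
  nonneg := h.nonneg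
  init := by
    rw [h.init]
    exact funext fun v => by
      by_cases hv : v ∈ both X
      · simpa [hv] using hτ hv
      · simp [hv]
  hasDeriv x hx := by
    simpa [mem_both_of_mem hx, prime_mem_both_of_mem hx] using h.hasDeriv x (hXY hx)
  contDeriv x hx := by simpa [prime_mem_both_of_mem hx] using h.contDeriv x (hXY hx)
  const y hy t _ := by simp [hy]
  sat := hG

end IsSolution

theorem sat_box_dap {X : List Var} {F : RA} {P : Form} {σ : State} :
    (Form.box (.dap X F) P).sat σ ↔
      ∀ T f, IsSolution X F σ T f → ∀ t ∈ Icc 0 T, P.sat (f t) := by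
  refine ⟨fun h T f hf t ht => h _ (hf.restrict ht).ofFun_mem_sem, fun h φ hφ => ?_⟩
  rw [φ.final_eq_ext]
  exact h _ _ (.of_mem_sem hφ) _ ⟨φ.dur_nonneg, le_rfl⟩

theorem sat_ref_dap {X Y Z : List Var} {F G : RA} {σ : State} :
    (Form.ref X (.dap Y F) (.dap Z G)).sat σ ↔
      ∀ T f, IsSolution Y F σ T f →
        ∃ g, IsSolution Z G σ T g ∧ ∀ t ∈ Icc 0 T, EqOn (f t) (g t) (both X) := by
  constructor
  · intro h T f hf
    obtain ⟨ψ, hψ, hc⟩ := h _ hf.ofFun_mem_sem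
    obtain ⟨rfl : T = ψ.dur, hagree⟩ := Trace.coincide_iff_agreeOn.1 hc
    refine ⟨ψ.ext, .of_mem_sem hψ, fun t ht => ?_⟩
    rw [← Trace.ext_ofFun hf.nonneg f ht]
    exact hagree t ht
  · intro h φ hφ
    obtain ⟨g, hg, hagree⟩ := h _ _ (.of_mem_sem hφ)
    refine ⟨_, hg.ofFun_mem_sem, Trace.coincide_iff_agreeOn.2 ⟨rfl, fun t ht => ?_⟩⟩
    rw [Trace.ext_ofFun hg.nonneg g ht]
    exact hagree t ht

theorem sat_ref_dap_self {X : List Var} {F G : RA} {σ : State} :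
    (Form.ref X (.dap X F) (.dap X G)).sat σ ↔
      ∀ T f, IsSolution X F σ T f → ∀ t ∈ Icc 0 T, G.sat (f t) := by
  rw [sat_ref_dap]
  refine ⟨fun h T f hf t ht => ?_, fun h T f hf => ⟨f, hf.withSat (h T f hf), fun _ _ _ _ => rfl⟩⟩
  obtain ⟨g, hg, hagree⟩ := h T f hf
  have hfg : f t = g t := funext fun v => by
    by_cases hv : v ∈ both X
    · exact hagree t ht hv
    · rw [hf.const v hv t ht, hg.const v hv t ht]
  exact hfg ▸ hg.sat t ht

/-! ### Reachability and the bound effect lemma -/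

/-- The transition relation of a program: `τ` is the final state of a trace from `σ`. -/
def Prog.Reaches (α : Prog) (σ τ : State) : Prop := ∃ φ ∈ α.sem σ, φ.final = τ

theorem sat_box_iff {α : Prog} {P : Form} {σ : State} :
    (Form.box α P).sat σ ↔ ∀ τ, α.Reaches σ τ → P.sat τ :=
  ⟨fun h _ ⟨φ, hφ, hτ⟩ => hτ ▸ h φ hφ, fun h φ hφ => h _ ⟨φ, hφ, rfl⟩⟩

section Reaches

variable {α β : Prog} {σ τ : State}

theorem reaches_assign {x : Var} {e : Term} :
    (Prog.assign x e).Reaches σ τ ↔ τ = Function.update σ x (e.eval σ) := by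
  simp [Prog.Reaches, Prog.sem, Trace.point, Trace.final, eq_comm]

theorem reaches_test {Q : RA} : (Prog.test Q).Reaches σ τ ↔ Q.sat σ ∧ τ = σ := by
  simp [Prog.Reaches, Prog.sem, Trace.point, Trace.final, eq_comm]

theorem reaches_choice : (Prog.choice α β).Reaches σ τ ↔ α.Reaches σ τ ∨ β.Reaches σ τ := by
  simp only [Prog.Reaches, Prog.sem, mem_union, or_and_right, exists_or]

theorem exists_mem_seqSem_final_eq {A B : State → Set Trace} :
    (∃ χ ∈ seqSem A B σ, χ.final = τ) ↔ ∃ φ ∈ A σ, ∃ ψ ∈ B φ.final, ψ.final = τ := by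
  constructor
  · rintro ⟨_, ⟨φ, hφ, ψ, hψ, rfl⟩, h⟩
    exact ⟨φ, hφ, ψ, hψ, by rwa [Trace.final_concat] at h⟩
  · rintro ⟨φ, hφ, ψ, hψ, h⟩
    exact ⟨_, ⟨φ, hφ, ψ, hψ, rfl⟩, by rwa [Trace.final_concat]⟩

theorem reaches_seq : (Prog.seq α β).Reaches σ τ ↔ ∃ ρ, α.Reaches σ ρ ∧ β.Reaches ρ τ := by
  refine exists_mem_seqSem_final_eq.trans ⟨?_, ?_⟩
  · rintro ⟨φ, hφ, h⟩
    exact ⟨_, ⟨φ, hφ, rfl⟩, h⟩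
  · rintro ⟨_, ⟨φ, hφ, rfl⟩, h⟩
    exact ⟨φ, hφ, h⟩

theorem reaches_loop : (Prog.loop α).Reaches σ τ ↔ Relation.ReflTransGen α.Reaches σ τ := by
  constructor
  · rintro ⟨φ, hφ, hτ⟩
    obtain ⟨n, hn⟩ := mem_iUnion.1 hφ
    induction n generalizing σ φ with
    | zero =>
      obtain rfl : φ = Trace.point σ := hn
      exact hτ ▸ .refl
    | succ n ih =>
      obtain ⟨φ₁, h₁, φ₂, h₂, h⟩ := exists_mem_seqSem_final_eq.1 ⟨φ, hn, hτ⟩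
      exact .head ⟨φ₁, h₁, rfl⟩ (ih φ₂ (mem_iUnion.2 ⟨n, h₂⟩) h h₂)
  · intro h
    suffices ∃ n, ∃ φ ∈ iterSem α.sem n σ, φ.final = τ by
      obtain ⟨n, φ, hφ, hτ⟩ := this
      exact ⟨φ, mem_iUnion.2 ⟨n, hφ⟩, hτ⟩
    induction h using Relation.ReflTransGen.head_induction_on with
    | refl => exact ⟨0, _, rfl, rfl⟩
    | head h₁ _ ih =>
      obtain ⟨φ, hφ, rfl⟩ := h₁
      obtain ⟨n, hn⟩ := ih
      exact ⟨n + 1, exists_mem_seqSem_final_eq.2 ⟨φ, hφ, hn⟩⟩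

theorem Prog.Reaches.eq_of_notMem_bv (h : α.Reaches σ τ) {v : Var} (hv : v ∉ α.bv) :
    τ v = σ v := by
  induction α generalizing σ τ with
  | assign x e =>
    rw [reaches_assign.1 h]
    exact Function.update_of_ne (by simpa [bv] using hv) _ _
  | test Q => rw [(reaches_test.1 h).2]
  | dap X F =>
    obtain ⟨φ, hφ, rfl⟩ := h
    rw [φ.final_eq_ext]
    exact (IsSolution.of_mem_sem hφ).const v hv _ ⟨φ.dur_nonneg, le_rfl⟩
  | choice α β ihα ihβ =>
    simp only [bv, Finset.mem_union, not_or] at hv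
    exact (reaches_choice.1 h).elim (ihα · hv.1) (ihβ · hv.2)
  | seq α β ihα ihβ =>
    simp only [bv, Finset.mem_union, not_or] at hv
    obtain ⟨ρ, h₁, h₂⟩ := reaches_seq.1 h
    exact (ihβ h₂ hv.2).trans (ihα h₁ hv.1)
  | loop α ih =>
    induction reaches_loop.1 h with
    | refl => rfl
    | tail h₁ h₂ ih' => exact (ih h₂ hv).trans (ih' (reaches_loop.2 h₁))

end Reaches

/-! ### Coincidence -/

/-- The trace semantics `A` reads no variable outside `V`, and it sets every variable in `M`: from
states that agree on `V` it has traces that agree on `V`, with final states that agree on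
`V ∪ M`. -/
def DependsOn (A : State → Set Trace) (V M : Finset Var) : Prop :=
  ∀ ⦃σ τ⦄, EqOn σ τ V → ∀ φ ∈ A σ,
    ∃ ψ ∈ A τ, φ.AgreeOn V ψ ∧ EqOn φ.final ψ.final (V ∪ M : Finset Var)

namespace DependsOn

variable {A B : State → Set Trace} {V M N : Finset Var}

theorem mono (h : DependsOn A V M) (hNM : N ⊆ M) : DependsOn A V N := fun σ τ hστ φ hφ => by
  obtain ⟨ψ, hψ, hagree, hfinal⟩ := h hστ φ hφ
  exact ⟨ψ, hψ, hagree, hfinal.mono (Finset.coe_subset.2 (Finset.union_subset_union_right hNM))⟩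

theorem seqSem (hA : DependsOn A V M) (hB : DependsOn B (V ∪ M) N) :
    DependsOn (seqSem A B) V (M ∪ N) := by
  rintro σ τ hστ _ ⟨φ₁, h₁, φ₂, h₂, rfl⟩
  obtain ⟨ψ₁, hψ₁, hagree₁, hfinal₁⟩ := hA hστ φ₁ h₁
  obtain ⟨ψ₂, hψ₂, hagree₂, hfinal₂⟩ := hB hfinal₁ φ₂ h₂
  refine ⟨_, ⟨ψ₁, hψ₁, ψ₂, hψ₂, rfl⟩, hagree₁.concat (hagree₂.mono Finset.subset_union_left), ?_⟩
  rwa [Trace.final_concat, Trace.final_concat, ← Finset.union_assoc]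

theorem iterSem (hA : DependsOn A V ∅) (n : ℕ) : DependsOn (iterSem A n) V ∅ := by
  induction n with
  | zero =>
    rintro σ τ hστ _ rfl
    exact ⟨_, rfl, Trace.agreeOn_point hστ, hστ.mono (by simp)⟩
  | succ n ih =>
    rw [← Finset.union_empty V] at ih
    exact hA.seqSem ih

theorem dap {X : List Var} {F : RA} (hV : both X ∪ F.fv ⊆ V) :
    DependsOn (Prog.dap X F).sem V (both X) := by
  intro σ τ hστ φ hφ
  have hX : both X ⊆ V := Finset.subset_union_left.trans hV
  have hf := IsSolution.of_mem_sem hφ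
  have heq : ∀ t ∈ Icc 0 φ.dur, EqOn (φ.ext t) ((both X).piecewise (φ.ext t) τ) V := by
    intro t ht v hv
    by_cases hvX : v ∈ both X
    · simp [hvX]
    · simpa [hvX, hf.const v hvX t ht] using hστ hv
  have hg := hf.piecewise (G := F) (List.Subset.refl X) (hστ.mono (Finset.coe_subset.2 hX))
    fun t ht => (RA.sat_congr ((heq t ht).mono
      (Finset.coe_subset.2 (Finset.subset_union_right.trans hV)))).1 (hf.sat t ht)
  have hagree : φ.AgreeOn V (Trace.ofFun φ.dur hg.nonneg _) := ⟨rfl, fun t ht => by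
    rw [Trace.ext_ofFun hg.nonneg _ ht]
    exact heq t ht⟩
  refine ⟨_, hg.ofFun_mem_sem, hagree, ?_⟩
  rw [Finset.union_eq_left.2 hX]
  exact hagree.final

end DependsOn

theorem Prog.sem_dependsOn (α : Prog) {V : Finset Var} (hV : α.fv ⊆ V) :
    DependsOn α.sem V α.mbv := by
  induction α generalizing V with
  | assign x e =>
    rintro σ τ hστ _ rfl
    have heq : EqOn (Function.update σ x (e.eval σ)) (Function.update τ x (e.eval τ))
        (V ∪ {x} : Finset Var) := by
      rw [e.eval_congr (hστ.mono (Finset.coe_subset.2 hV))]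
      exact eqOn_update_of_eqOn_erase (hστ.mono (by simp)) _
    exact ⟨_, rfl, Trace.agreeOn_point (heq.mono (by simp)), heq⟩
  | test Q =>
    rintro σ τ hστ _ ⟨rfl, hQ⟩
    exact ⟨_, ⟨rfl, (RA.sat_congr (hστ.mono (Finset.coe_subset.2 hV))).1 hQ⟩,
      Trace.agreeOn_point hστ, hστ.mono (by simp [mbv])⟩
  | dap X F => exact .dap hV
  | choice α β ihα ihβ =>
    rintro σ τ hστ φ (hφ | hφ)
    · obtain ⟨ψ, hψ, h⟩ := (ihα (Finset.subset_union_left.trans hV)).mono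
        Finset.inter_subset_left hστ φ hφ
      exact ⟨ψ, .inl hψ, h⟩
    · obtain ⟨ψ, hψ, h⟩ := (ihβ (Finset.subset_union_right.trans hV)).mono
        Finset.inter_subset_right hστ φ hφ
      exact ⟨ψ, .inr hψ, h⟩
  | seq α β ihα ihβ =>
    refine (ihα (Finset.subset_union_left.trans hV)).seqSem (ihβ ?_)
    exact sdiff_le_iff'.1 (Finset.subset_union_right.trans hV)
  | loop α ih =>
    intro σ τ hστ φ hφ
    obtain ⟨n, hn⟩ := mem_iUnion.1 hφ
    obtain ⟨ψ, hψ, h⟩ := ((ih hV).mono (Finset.empty_subset _)).iterSem n hστ φ hn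
    exact ⟨ψ, mem_iUnion.2 ⟨n, hψ⟩, h⟩

theorem Form.sat_congr {P : Form} {σ τ : State} (h : EqOn σ τ P.fv) : P.sat σ ↔ P.sat τ := by
  suffices ∀ {σ τ : State}, EqOn σ τ P.fv → P.sat σ → P.sat τ from ⟨this h, this h.symm⟩
  clear h
  intro σ τ h hP
  induction P generalizing σ τ with
  | le e g =>
    rwa [sat, ← e.eval_congr (h.mono (by simp [fv])), ← g.eval_congr (h.mono (by simp [fv]))]
  | neg P ih => exact fun hτ => hP (ih h.symm hτ)
  | and P Q ihP ihQ =>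
    exact ⟨ihP (h.mono (by simp [fv])) hP.1, ihQ (h.mono (by simp [fv])) hP.2⟩
  | all x P ih => exact fun r => ih (eqOn_update_of_eqOn_erase h r) (hP r)
  | box α P ih =>
    intro φ hφ
    obtain ⟨ψ, hψ, -, hfinal⟩ := α.sem_dependsOn (V := (Form.box α P).fv)
      Finset.subset_union_left h.symm φ hφ
    refine ih (hfinal.symm.mono (Finset.coe_subset.2 ?_)) (hP ψ hψ)
    exact sdiff_le_iff'.1 Finset.subset_union_right
  | ref X α β =>
    obtain ⟨hαβ, hX⟩ := Finset.union_subset_iff.1 (Finset.Subset.refl (Form.ref X α β).fv)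
    obtain ⟨hα, hβ⟩ := Finset.union_subset_iff.1 hαβ
    intro φ hφ
    obtain ⟨φ', hφ', hagree, -⟩ := α.sem_dependsOn hα h.symm φ hφ
    obtain ⟨ψ', hψ', hc⟩ := hP φ' hφ'
    obtain ⟨ψ, hψ, hagree', -⟩ := β.sem_dependsOn hβ h ψ' hψ'
    exact ⟨ψ, hψ, Trace.coincide_iff_agreeOn.2
      (((hagree.mono hX).trans (Trace.coincide_iff_agreeOn.1 hc)).trans (hagree'.mono hX))⟩

/-! ### Linear differential equations -/

section ODE

open scoped NNReal

variable {E ι : Type*} [NormedAddCommGroup E] [NormedSpace ℝ E] {T : ℝ} {K : ℝ≥0}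

theorem exists_hasDerivWithinAt_of_lipschitz_of_bounded [CompleteSpace E] {v : ℝ → E → E}
    {L : ℝ≥0} (hT : 0 ≤ T) (hlip : ∀ t ∈ Icc 0 T, LipschitzWith K (v t))
    (hcont : ∀ x, ContinuousOn (fun t => v t x) (Icc 0 T))
    (hbound : ∀ t ∈ Icc 0 T, ∀ x, ‖v t x‖ ≤ L) (x₀ : E) :
    ∃ y : ℝ → E, y 0 = x₀ ∧ ∀ t ∈ Icc 0 T, HasDerivWithinAt y (v t (y t)) (Icc 0 T) t := by
  have hPL : IsPicardLindelof v (tmin := 0) (tmax := T) ⟨0, le_rfl, hT⟩ x₀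
      (L * .mk T hT) 0 L K :=
    { lipschitzOnWith := fun t ht => (hlip t ht).lipschitzOnWith
      continuousOn := fun x _ => hcont x
      norm_le := fun t ht x _ => hbound t ht x
      mul_max_le := by simp [max_eq_left hT] }
  exact hPL.exists_eq_forall_mem_Icc_hasDerivWithinAt₀

theorem norm_le_gronwallBound_of_hasDerivWithinAt {y y' : ℝ → E} {B : ℝ} (hB : 0 ≤ B)
    (hy : ∀ t ∈ Icc 0 T, HasDerivWithinAt y (y' t) (Icc 0 T) t)
    (hbound : ∀ t ∈ Icc 0 T, ‖y' t‖ ≤ K * ‖y t‖ + B) {t : ℝ} (ht : t ∈ Icc 0 T) :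
    ‖y t‖ ≤ gronwallBound ‖y 0‖ K B T := by
  refine (norm_le_gronwallBound_of_norm_deriv_right_le
    (fun t ht => (hy t ht).continuousWithinAt) (fun t ht => ?_) le_rfl
    (fun t ht => hbound t (Ico_subset_Icc_self ht)) t ht).trans ?_
  · exact (hy t (Ico_subset_Icc_self ht)).mono_of_mem_nhdsWithin (Icc_mem_nhdsGE_of_mem ht)
  · exact gronwallBound_mono (norm_nonneg _) hB K.coe_nonneg (by simpa using ht.2)

/-- Coordinatewise truncation of a vector to the cube `[-R, R]^ι`. It turns a Lipschitz vector field
into a bounded one without changing it on the cube. -/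
def clamp (R : ℝ) (x : ι → ℝ) : ι → ℝ := fun i => max (-R) (min R (x i))

variable [Fintype ι]

theorem clamp_eq_self {R : ℝ} {x : ι → ℝ} (hx : ‖x‖ ≤ R) : clamp R x = x := by
  funext i
  obtain ⟨hneg, hpos⟩ := abs_le.1 ((norm_le_pi_norm x i).trans hx)
  simp [clamp, hneg, hpos]

theorem norm_clamp_le {R : ℝ} (hR : 0 ≤ R) (x : ι → ℝ) : ‖clamp R x‖ ≤ R :=
  (pi_norm_le_iff_of_nonneg hR).2 fun _ =>
    abs_le.2 ⟨le_max_left _ _, max_le (by linarith) (min_le_left _ _)⟩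

theorem lipschitzWith_clamp (R : ℝ) : LipschitzWith 1 (clamp R : (ι → ℝ) → ι → ℝ) :=
  LipschitzWith.of_dist_le_mul fun x y => (dist_pi_le_iff (by positivity)).2 fun i =>
    (((LipschitzWith.eval i).const_min R).const_max (-R)).dist_le_mul x y

theorem norm_clamp_le_norm {R : ℝ} (hR : 0 ≤ R) (x : ι → ℝ) : ‖clamp R x‖ ≤ ‖x‖ := by
  simpa [clamp_eq_self (show ‖(0 : ι → ℝ)‖ ≤ R by simpa)] using
    (lipschitzWith_clamp R).norm_sub_le x 0

theorem exists_hasDerivWithinAt_of_lipschitz {v : ℝ → (ι → ℝ) → ι → ℝ} (hT : 0 ≤ T)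
    (hlip : ∀ t ∈ Icc 0 T, LipschitzWith K (v t))
    (hcont : ∀ x, ContinuousOn (fun t => v t x) (Icc 0 T)) (x₀ : ι → ℝ) :
    ∃ y : ℝ → ι → ℝ, y 0 = x₀ ∧
      ∀ t ∈ Icc 0 T, HasDerivWithinAt y (v t (y t)) (Icc 0 T) t := by
  obtain ⟨B, hB⟩ := isCompact_Icc.exists_bound_of_continuousOn (hcont 0)
  have hB0 : 0 ≤ B := (norm_nonneg _).trans (hB 0 ⟨le_rfl, hT⟩)
  have hgrowth : ∀ t ∈ Icc 0 T, ∀ x, ‖v t x‖ ≤ K * ‖x‖ + B := fun t ht x => by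
    have hsub := (hlip t ht).norm_sub_le x 0
    rw [sub_zero] at hsub
    linarith [hB t ht, norm_le_norm_sub_add (v t x) (v t 0)]
  have hmono := gronwallBound_mono (norm_nonneg x₀) hB0 K.coe_nonneg
  set R : ℝ := gronwallBound ‖x₀‖ K B T
  have hR : 0 ≤ R := by
    have := hmono hT
    rw [gronwallBound_x0] at this
    exact (norm_nonneg x₀).trans this
  -- The truncated field satisfies the same growth bound, so its solution stays in the cube.
  obtain ⟨y, rfl, hy⟩ := exists_hasDerivWithinAt_of_lipschitz_of_bounded (K := K)
    (v := fun t x => v t (clamp R x)) (L := .mk (K * R + B) (by positivity)) hT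
    (fun t ht => mul_one K ▸ (hlip t ht).comp (lipschitzWith_clamp R))
    (fun x => hcont _)
    (fun t ht x => (hgrowth t ht _).trans (by
      rw [NNReal.coe_mk]
      gcongr
      exact norm_clamp_le hR x)) x₀
  have hbound : ∀ t ∈ Icc 0 T, ‖y t‖ ≤ R := fun t ht =>
    norm_le_gronwallBound_of_hasDerivWithinAt hB0 hy (fun t ht => (hgrowth t ht _).trans (by
      gcongr
      exact norm_clamp_le_norm hR _)) ht
  exact ⟨y, rfl, fun t ht => by simpa only [clamp_eq_self (hbound t ht)] using hy t ht⟩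

theorem exists_hasDerivWithinAt_linear {M : ℝ → Matrix ι ι ℝ} {d : ℝ → ι → ℝ} (hT : 0 ≤ T)
    (hM : ContinuousOn M (Icc 0 T)) (hd : ContinuousOn d (Icc 0 T)) (x₀ : ι → ℝ) :
    ∃ y : ℝ → ι → ℝ, y 0 = x₀ ∧
      ∀ t ∈ Icc 0 T, HasDerivWithinAt y (M t *ᵥ y t + d t) (Icc 0 T) t := by
  classical
  let Φ : Matrix ι ι ℝ →ₗ[ℝ] ((ι → ℝ) →L[ℝ] (ι → ℝ)) :=
    LinearMap.toContinuousLinearMap.toLinearMap ∘ₗ Matrix.toLin'.toLinearMap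
  have hΦ : ∀ A x, Φ A x = A *ᵥ x := fun A x => by simp [Φ]
  have hΦM : ContinuousOn (fun t => Φ (M t)) (Icc 0 T) :=
    Φ.continuous_of_finiteDimensional.comp_continuousOn hM
  obtain ⟨K, hK⟩ := isCompact_Icc.exists_bound_of_continuousOn hΦM
  refine exists_hasDerivWithinAt_of_lipschitz (K := K.toNNReal) hT
    (v := fun t x => M t *ᵥ x + d t) (fun t ht => ?_) (fun x => ?_) x₀
  · have hlip : LipschitzWith K.toNNReal (Φ (M t)) :=
      (Φ (M t)).lipschitz.weaken (NNReal.le_toNNReal_of_coe_le (hK t ht))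
    refine LipschitzWith.of_dist_le_mul fun x y => ?_
    rw [dist_add_right, ← hΦ, ← hΦ]
    exact hlip.dist_le_mul x y
  · exact ((Continuous.matrix_mulVec continuous_id continuous_const).comp_continuousOn hM).add hd

end ODE

/-! ### Differential invariants -/

namespace IsSolution

variable {X P : List Var} {F : RA} {σ : State} {T : ℝ} {f : ℝ → State} {e : Term}

theorem hasDerivWithinAt_eval (h : IsSolution X F σ T f) (he : TermIn X P e)
    (hP : ∀ p ∈ P, σ p.prime = 0) {t : ℝ} (ht : t ∈ Icc 0 T) :
    HasDerivWithinAt (fun s => e.eval (f s)) ((Term.diff e).eval (f t)) (Icc 0 T) t := by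
  refine e.hasDerivWithinAt_eval_of_prime (h.continuousOn t ht) fun v hv => ?_
  by_cases hX : v ∈ X
  · exact h.hasDeriv v hX t ht
  · have hvP : v ∈ P := by simpa [hX] using he.1 hv
    have hfresh := Finset.disjoint_left.1 he.2
    rw [h.const _ (hfresh (prime_mem_both_of_mem hvP)) t ht, hP v hvP]
    exact h.hasDeriv_of_notMem (hfresh (mem_both_of_mem hvP)) ht

theorem eval_le_eval_init (h : IsSolution X (.le (.diff e) (.const 0)) σ T f)
    (he : TermIn X P e) (hP : ∀ p ∈ P, σ p.prime = 0) {t : ℝ} (ht : t ∈ Icc 0 T) :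
    e.eval (f t) ≤ e.eval σ := by
  have hanti : AntitoneOn (fun s => e.eval (f s)) (Icc 0 T) :=
    antitoneOn_of_hasDerivWithinAt_nonpos (convex_Icc 0 T)
      (fun s hs => (h.hasDerivWithinAt_eval he hP hs).continuousWithinAt)
      (fun s hs => (h.hasDerivWithinAt_eval he hP (interior_subset hs)).mono interior_subset)
      (fun s hs => by simpa [RA.sat, Term.eval] using h.sat s (interior_subset hs))
  simpa only [h.init] using hanti ⟨le_rfl, h.nonneg⟩ ht ht.1

theorem eval_diff_eq_zero (h : IsSolution X (RA.eq e (.const 0)) σ T f) (he : TermIn X P e)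
    (hP : ∀ p ∈ P, σ p.prime = 0) (h0 : (Term.diff e).eval σ = 0) {t : ℝ} (ht : t ∈ Icc 0 T) :
    (Term.diff e).eval (f t) = 0 := by
  rcases h.nonneg.eq_or_lt with rfl | hT
  · rw [Icc_self, mem_singleton_iff] at ht
    rwa [ht, h.init]
  · have hconst : HasDerivWithinAt (fun s => e.eval (f s)) 0 (Icc 0 T) t :=
      (hasDerivWithinAt_const t _ (0 : ℝ)).congr_of_mem
        (fun s hs => by simpa [Term.eval] using h.sat s hs) ht
    exact (uniqueDiffOn_Icc hT t ht).eq_deriv _ (h.hasDerivWithinAt_eval he hP ht) hconst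

end IsSolution

/-! ### Ghost variables -/

theorem Var.prime_injective : Function.Injective Var.prime := fun x y h => by
  simpa [Var.prime, Var.ext_iff] using h

section Ghosts

variable {m : ℕ} {Z : Fin m → Var} {X : List Var}

theorem mem_both_ofFn {v : Var} :
    v ∈ both (List.ofFn Z) ↔ (∃ i, Z i = v) ∨ ∃ i, (Z i).prime = v := by
  simp [mem_both, List.mem_ofFn]

theorem Ghost.injective (h : Ghost (List.ofFn Z) X) : Function.Injective Z :=
  List.nodup_ofFn.1 (List.nodup_append.1 h.1).1

theorem Ghost.ne_prime (h : Ghost (List.ofFn Z) X) (i j : Fin m) : Z i ≠ (Z j).prime :=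
  (List.nodup_append.1 h.1).2.2 _ (by simp [List.mem_ofFn]) _ (by simp [primes, List.mem_ofFn])

/-- The state `τ` with the values of the ghost variables `Z` replaced by `a` and those of `Z'`
replaced by `b`. -/
def overlay (Z : Fin m → Var) (a b : Fin m → ℝ) (τ : State) : State :=
  Function.extend Z a (Function.extend (fun i => (Z i).prime) b τ)

variable {a b : Fin m → ℝ} {σ ρ τ : State}

theorem overlay_var (hZ : Function.Injective Z) (i : Fin m) : overlay Z a b τ (Z i) = a i :=
  hZ.extend_apply a _ i

theorem overlay_prime (hZ : Ghost (List.ofFn Z) X) (i : Fin m) :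
    overlay Z a b τ (Z i).prime = b i := by
  rw [overlay, Function.extend_apply' _ _ _ fun ⟨j, hj⟩ => hZ.ne_prime j i hj]
  exact (Var.prime_injective.comp hZ.injective).extend_apply b τ i

theorem overlay_of_notMem {v : Var} (hv : v ∉ both (List.ofFn Z)) : overlay Z a b τ v = τ v := by
  rw [mem_both_ofFn, not_or] at hv
  rw [overlay, Function.extend_apply' _ _ _ hv.1, Function.extend_apply' _ _ _ hv.2]

theorem overlay_apply_of_notMem_primes (hZ : Function.Injective Z)
    (hρ : ∀ v ∉ List.ofFn Z, ρ v = σ v) {v : Var} (hv : v ∉ primes (List.ofFn Z)) :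
    overlay Z (ρ ∘ Z) b σ v = ρ v := by
  by_cases hvZ : v ∈ List.ofFn Z
  · obtain ⟨i, rfl⟩ := List.mem_ofFn.1 hvZ
    exact overlay_var hZ i
  · rw [hρ v hvZ]
    exact overlay_of_notMem (by simp [both, hv, hvZ])

theorem eval_overlay {e : Term} (he : Disjoint (both (List.ofFn Z)) e.fv) :
    e.eval (overlay Z a b τ) = e.eval τ :=
  e.eval_congr fun _ hv => overlay_of_notMem (Finset.disjoint_right.1 he hv)

theorem IsSolution.overlay {F R : RA} {T : ℝ} {f : ℝ → State} {y w : ℝ → Fin m → ℝ}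
    (h : IsSolution X F σ T f) (hZ : Ghost (List.ofFn Z) X)
    (hF : Disjoint (both (List.ofFn Z)) F.fv)
    (hy : ∀ t ∈ Icc 0 T, HasDerivWithinAt y (w t) (Icc 0 T) t) (hw : ContinuousOn w (Icc 0 T))
    (hR : ∀ t ∈ Icc 0 T, R.sat (overlay Z (y t) (w t) (f t))) :
    IsSolution (X ++ List.ofFn Z) (.and F R) (DAL.overlay Z (y 0) (w 0) σ) T
      fun t => DAL.overlay Z (y t) (w t) (f t) where
  nonneg := h.nonneg
  init := by rw [h.init]
  hasDeriv x hx t ht := by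
    rcases List.mem_append.1 hx with hx | hx
    · have hfresh := Finset.disjoint_right.1 hZ.2
      simpa only [overlay_of_notMem (hfresh (mem_both_of_mem hx)),
        overlay_of_notMem (hfresh (prime_mem_both_of_mem hx))] using h.hasDeriv x hx t ht
    · obtain ⟨i, rfl⟩ := List.mem_ofFn.1 hx
      simpa only [overlay_var hZ.injective, overlay_prime hZ] using
        hasDerivWithinAt_pi.1 (hy t ht) i
  contDeriv x hx := by
    rcases List.mem_append.1 hx with hx | hx
    · simpa only [overlay_of_notMem (Finset.disjoint_right.1 hZ.2 (prime_mem_both_of_mem hx))]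
        using h.contDeriv x hx
    · obtain ⟨i, rfl⟩ := List.mem_ofFn.1 hx
      simpa only [overlay_prime hZ] using continuousOn_pi.1 hw i
  const v hv t ht := by
    rw [both_append, Finset.mem_union, not_or] at hv
    rw [overlay_of_notMem hv.2, overlay_of_notMem hv.2, h.const v hv.1 t ht]
  sat t ht := ⟨(RA.sat_congr fun _ hv => overlay_of_notMem (Finset.disjoint_right.1 hF hv)).2
    (h.sat t ht), hR t ht⟩

/-- The initial values `b` of `Z'` are chosen before the trace, hence uniformly in `f`. -/
theorem sat_exs_primes_ref {F R : RA} (hZ : Ghost (List.ofFn Z) X)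
    (hF : Disjoint (both (List.ofFn Z)) F.fv) (hρ : ∀ v ∉ List.ofFn Z, ρ v = σ v)
    (h : ∀ T f, IsSolution X F σ T f → ∃ y w : ℝ → Fin m → ℝ, y 0 = ρ ∘ Z ∧ w 0 = b ∧
      ContinuousOn w (Icc 0 T) ∧ ∀ t ∈ Icc 0 T, HasDerivWithinAt y (w t) (Icc 0 T) t ∧
        R.sat (overlay Z (y t) (w t) (f t))) :
    (Form.exs (primes (List.ofFn Z))
      (.ref X (.dap X F) (.dap (X ++ List.ofFn Z) (.and F R)))).sat ρ := by
  refine (Form.sat_exs _ _ _).2 ⟨overlay Z (ρ ∘ Z) b σ,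
    fun v hv => overlay_apply_of_notMem_primes hZ.injective hρ hv, sat_ref_dap.2 fun T f hf => ?_⟩
  have hinit : EqOn (overlay Z (ρ ∘ Z) b σ) σ (both X) := fun v hv =>
    overlay_of_notMem (Finset.disjoint_right.1 hZ.2 hv)
  have hg : IsSolution X F σ T fun t => (both X).piecewise (f t) σ := by
    refine hf.piecewise (List.Subset.refl X) hinit fun t ht =>
      (RA.sat_congr fun v hv => ?_).1 (hf.sat t ht)
    by_cases hX : v ∈ both X
    · simp [hX]
    · simp [hX, hf.const v hX t ht, overlay_of_notMem (Finset.disjoint_right.1 hF hv)]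
  obtain ⟨y, w, hy0, rfl, hw, hyw⟩ := h T _ hg
  refine ⟨_, hy0 ▸ hg.overlay hZ hF (fun t ht => (hyw t ht).1) hw fun t ht => (hyw t ht).2,
    fun t _ v hv => ?_⟩
  rw [overlay_of_notMem (Finset.disjoint_right.1 hZ.2 hv), Finset.piecewise_eq_of_mem _ _ _ hv]

end Ghosts

/-! ### Implicit differentiation along solutions -/

/-- The derivative at the state `τ` of the variables outside `X'` along a solution of `{X : F}`. -/
def explicitRate (X : List Var) (τ : State) (v : Var) : ℝ := if v ∈ X then τ v.prime else 0

/-- The derivative at the state `τ` of all variables along a solution on which `e = 0` and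
`det J_{X'}(e) ≠ 0`: differentiating `e = 0` yields a linear system for the derivatives of `X'`,
which take precedence when `X` and `X'` overlap. -/
def implicitRate {n : ℕ} (X : Fin n → Var) (e : Fin n → Term) (τ : State) : Var → ℝ :=
  let W : Fin n → Var := fun j => (X j).prime
  let U : Finset Var := (Finset.univ.biUnion fun i => (e i).fv) \ Finset.univ.image W
  Function.extend W
    ((jacobianAt (fun i => (e i).poly) W τ)⁻¹ *ᵥ fun i =>
      -∑ v ∈ U, explicitRate (List.ofFn X) τ v * eval τ (pderiv v (e i).poly))
    (explicitRate (List.ofFn X) τ)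

namespace IsSolution

section

variable {X : List Var} {F : RA} {σ : State} {T : ℝ} {f : ℝ → State}

theorem hasDeriv_explicitRate (h : IsSolution X F σ T f) {v : Var} (hv : v ∉ primes X) {t : ℝ}
    (ht : t ∈ Icc 0 T) :
    HasDerivWithinAt (fun s => f s v) (explicitRate X (f t) v) (Icc 0 T) t := by
  rw [explicitRate]
  split_ifs with hX
  · exact h.hasDeriv v hX t ht
  · exact h.hasDeriv_of_notMem (by simp [both, hX, hv]) ht

theorem continuousOn_explicitRate (h : IsSolution X F σ T f) (v : Var) :
    ContinuousOn (fun t => explicitRate X (f t) v) (Icc 0 T) := by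
  unfold explicitRate
  split_ifs with hX
  · exact h.contDeriv v hX
  · exact continuousOn_const

end

variable {n : ℕ} {X : Fin n → Var} {e : Fin n → Term} {F : RA} {σ : State} {T : ℝ} {f : ℝ → State}

theorem hasDeriv_implicitRate (h : IsSolution (List.ofFn X) F σ T f)
    (he : ∀ t ∈ Icc 0 T, ∀ i, (e i).eval (f t) = 0)
    (hdet : ∀ t ∈ Icc 0 T,
      (jacobianAt (fun i => (e i).poly) (fun j => (X j).prime) (f t)).det ≠ 0)
    (v : Var) {t : ℝ} (ht : t ∈ Icc 0 T) :
    HasDerivWithinAt (fun s => f s v) (implicitRate X e (f t) v) (Icc 0 T) t := by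
  by_cases hv : ∃ j, (X j).prime = v
  · obtain ⟨j, rfl⟩ := hv
    rw [implicitRate, (injective_of_det_jacobianAt_ne_zero (hdet t ht)).extend_apply]
    have hzero : ∀ r ∈ Icc 0 T, ∀ i, eval (f r) (e i).poly = 0 := by
      simpa only [Term.eval_eq_poly] using he
    refine hasDerivWithinAt_pi.1 (hasDerivWithinAt_of_implicit
      (d := explicitRate (List.ofFn X) (f t)) (fun i => ?_) Finset.sdiff_disjoint
      (h.continuousOn t ht) ht hzero (hdet t ht) fun v hv => ?_) j
    · rw [Finset.sdiff_union_self_eq_union]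
      exact (e i).vars_poly_subset.trans ((Finset.subset_biUnion_of_mem (fun i => (e i).fv)
        (Finset.mem_univ i)).trans Finset.subset_union_left)
    · refine h.hasDeriv_explicitRate ?_ ht
      simpa [primes, List.mem_ofFn] using (Finset.mem_sdiff.1 hv).2
  · rw [implicitRate, Function.extend_apply' _ _ _ hv]
    exact h.hasDeriv_explicitRate (by simpa [primes, List.mem_ofFn] using hv) ht

theorem continuousOn_implicitRate (h : IsSolution (List.ofFn X) F σ T f)
    (hdet : ∀ t ∈ Icc 0 T,
      (jacobianAt (fun i => (e i).poly) (fun j => (X j).prime) (f t)).det ≠ 0)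
    (v : Var) : ContinuousOn (fun t => implicitRate X e (f t) v) (Icc 0 T) := by
  by_cases hv : ∃ j, (X j).prime = v
  · obtain ⟨j, rfl⟩ := hv
    have hJ : ContinuousOn
        (fun t => (jacobianAt (fun i => (e i).poly) (fun j => (X j).prime) (f t))⁻¹)
        (Icc 0 T) := fun t ht => tendsto_matrix_inv
      (((continuous_matrix fun i j => MvPolynomial.continuous_eval _).tendsto _).comp
        (h.continuousOn t ht)) (hdet t ht)
    refine ContinuousOn.congr ?_ fun t ht => by
      rw [implicitRate, (injective_of_det_jacobianAt_ne_zero (hdet t ht)).extend_apply]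
    refine continuousOn_pi.1
      (fun t ht => tendsto_mulVec (hJ t ht) (tendsto_pi_nhds.2 fun i => ?_)) j
    exact (continuousOn_finsetSum _ fun v _ => (h.continuousOn_explicitRate v).mul
      ((MvPolynomial.continuous_eval _).comp_continuousOn h.continuousOn)).neg t ht
  · simp only [implicitRate, Function.extend_apply' _ _ _ hv]
    exact h.continuousOn_explicitRate v

end IsSolution

/-! ### Validity of the axioms -/

namespace Term

variable (e g : Term) (σ : State)

theorem eval_diff_const (c : ℚ) : (diff (const c)).eval σ = (const 0).eval σ := by
  simp [eval_eq_poly, poly]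

theorem eval_diff_var (x : Var) : (diff (var x)).eval σ = (var x.prime).eval σ := by
  simp [eval_eq_poly, poly]

theorem eval_diff_add : (diff (add e g)).eval σ = (add (diff e) (diff g)).eval σ := by
  simp [eval_eq_poly, poly]

theorem eval_diff_mul :
    (diff (mul e g)).eval σ = (add (mul (diff e) g) (mul e (diff g))).eval σ := by
  simp only [eval_eq_poly, poly, Derivation.leibniz, smul_eq_mul, map_add, map_mul]
  ring

end Term

variable {α β γ : Prog} {P Q : Form} {X Y Z : List Var} {F G R : RA} {σ : State} {m n : ℕ}

theorem sat_jacobian {X : Fin n → Var} {Y : List Var} {e : Fin m → Term}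
    (hX : Function.Injective X) (hop : ∀ i, (e i).OpFree)
    (he : ∀ i, TermIn (List.ofFn X) Y (e i)) (hY : ∀ p ∈ Y, σ p.prime = 0) :
    (RA.vecEq (fun i => .diff (e i)) (mulVec (jac X e) (dvars X))).sat σ := by
  refine (RA.sat_vecEq _ _ _).2 fun i => ?_
  have hfv : (e i).fv ⊆ Finset.univ.image X ∪ Y.toFinset := fun v hv => by
    simpa [List.mem_ofFn] using (he i).1 hv
  rw [eval_mulVec, (e i).eval_diff σ hfv, ← Finset.sum_subset Finset.subset_union_left,
    Finset.sum_image hX.injOn]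
  · exact Finset.sum_congr rfl fun j _ =>
      (mul_comm _ _).trans (congrArg (· * _) (Term.eval_pd (hop i) (X j) σ).symm)
  · intro v hv hvX
    rw [hY v (by simpa [hvX] using hv), zero_mul]

theorem sat_box_of_sat_ref (h : ∀ v ∈ P.fv, v ∈ X ∨ v ∉ α.bv ∪ β.bv)
    (href : (Form.ref X α β).sat σ) (hbox : (Form.box β P).sat σ) : (Form.box α P).sat σ := by
  intro φ hφ
  obtain ⟨ψ, hψ, hagree⟩ := href φ hφ
  refine (Form.sat_congr fun v hv => ?_).2 (hbox ψ hψ)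
  rcases h v hv with hvX | hvb
  · exact (Trace.coincide_iff_agreeOn.1 hagree).final (mem_both_of_mem hvX)
  · rw [Finset.mem_union, not_or] at hvb
    rw [Prog.Reaches.eq_of_notMem_bv ⟨φ, hφ, rfl⟩ hvb.1,
      Prog.Reaches.eq_of_notMem_bv ⟨ψ, hψ, rfl⟩ hvb.2]

theorem sat_ref_trans (h : (Form.ref X α β).sat σ) (h' : (Form.ref X β γ).sat σ) :
    (Form.ref X α γ).sat σ := by
  intro φ hφ
  obtain ⟨ψ, hψ, hφψ⟩ := h φ hφ
  obtain ⟨χ, hχ, hψχ⟩ := h' ψ hψ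
  exact ⟨χ, hχ, Trace.coincide_iff_agreeOn.2
    ((Trace.coincide_iff_agreeOn.1 hφψ).trans (Trace.coincide_iff_agreeOn.1 hψχ))⟩

theorem sat_differentialInduction_le {e : Term} (he : TermIn X Y e)
    (hY : ∀ p ∈ Y, σ p.prime = 0) (h : (RA.le e (.const 0)).toForm.sat σ) :
    (Form.box (.dap X (.le (.diff e) (.const 0))) (RA.le e (.const 0)).toForm).sat σ :=
  sat_box_dap.2 fun _ _ hf _ ht => (hf.eval_le_eval_init he hY ht).trans h

theorem sat_differentialInduction_lt {e : Term} (he : TermIn X Y e)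
    (hY : ∀ p ∈ Y, σ p.prime = 0) (h : (RA.lt e (.const 0)).toForm.sat σ) :
    (Form.box (.dap X (.le (.diff e) (.const 0))) (RA.lt e (.const 0)).toForm).sat σ := by
  simp only [RA.sat_toForm, RA.sat_lt, sat_box_dap] at h ⊢
  exact fun T f hf t ht => (hf.eval_le_eval_init he hY ht).trans_lt h

theorem sat_differentialHiddenConstraint {e : Term} (he : TermIn X Y e)
    (hY : ∀ p ∈ Y, σ p.prime = 0) (h : (RA.eq (.diff e) (.const 0)).toForm.sat σ) :
    (Form.box (.dap X (RA.eq e (.const 0))) (RA.eq (.diff e) (.const 0)).toForm).sat σ := by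
  have hconst (τ : State) : (Term.const 0).eval τ = 0 := Rat.cast_zero
  simp only [RA.sat_toForm, RA.sat_eq, hconst, sat_box_dap] at h ⊢
  exact fun T f hf t ht => hf.eval_diff_eq_zero he hY h ht

/-- The implicit function theorem is not needed: `X'` is differentiable along solutions, so the
derivatives of the components of `g` are continuous functions of the state. -/
theorem sat_algebraicGhost {X : Fin n → Var} {Z : Fin m → Var} {e : Fin n → Term}
    {g : Fin m → Term} (hop : ∀ i, (e i).OpFree) (hZ : Ghost (List.ofFn Z) (List.ofFn X))
    (hF : Disjoint (both (List.ofFn Z)) F.fv) (hg : ∀ i, Disjoint (both (List.ofFn Z)) (g i).fv)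
    (h : (Form.box (.dap (List.ofFn X) F) (RA.and (RA.vecEq e fun _ => .const 0)
      (RA.ne (mdet (jac (fun j => (X j).prime) e)) (.const 0))).toForm).sat σ) :
    (Form.exs (List.ofFn Z) (Form.exs (primes (List.ofFn Z))
      (.ref (List.ofFn X) (.dap (List.ofFn X) F)
        (.dap (List.ofFn X ++ List.ofFn Z) (.and F (RA.vecEq (vars Z) g)))))).sat σ := by
  let a (τ : State) (i : Fin m) : ℝ := (g i).eval τ
  let b (τ : State) (i : Fin m) : ℝ :=
    ∑ v ∈ (g i).fv, implicitRate X e τ v * eval τ (pderiv v (g i).poly)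
  refine (Form.sat_exs _ _ _).2 ⟨Function.extend Z (a σ) σ, fun v hv => ?_,
    sat_exs_primes_ref (σ := σ) (b := b σ) hZ hF (fun v hv => ?_) fun T f hf => ?_⟩
  · exact Function.extend_apply' _ _ _ fun hi => hv (List.mem_ofFn.2 hi)
  · exact Function.extend_apply' _ _ _ fun hi => hv (List.mem_ofFn.2 hi)
  have hconstr : ∀ t ∈ Icc 0 T, (∀ i, (e i).eval (f t) = 0) ∧
      (jacobianAt (fun i => (e i).poly) (fun j => (X j).prime) (f t)).det ≠ 0 := by
    simpa [eval_mdet, evalMat_jac_eq_jacobianAt hop, RA.sat, Term.eval] using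
      sat_box_dap.1 h T f hf
  have hdet := fun t ht => (hconstr t ht).2
  have hrate := hf.hasDeriv_implicitRate (fun t ht => (hconstr t ht).1) hdet
  refine ⟨fun t => a (f t), fun t => b (f t), ?_, by simp only [hf.init], ?_, fun t ht => ⟨?_, ?_⟩⟩
  · simp only [hf.init, Function.extend_comp hZ.injective]
  · exact continuousOn_pi.2 fun i => continuousOn_finsetSum _ fun v _ =>
      (hf.continuousOn_implicitRate hdet v).mul
        ((MvPolynomial.continuous_eval _).comp_continuousOn hf.continuousOn)
  · refine hasDerivWithinAt_pi.2 fun i => ?_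
    simpa only [a, Term.eval_eq_poly] using hasDerivWithinAt_eval (g i).vars_poly_subset
      (hf.continuousOn t ht) fun v _ => hrate v ht
  · refine (RA.sat_vecEq _ _ _).2 fun i => ?_
    rw [eval_overlay (hg i)]
    exact overlay_var hZ.injective i

theorem sat_differentialGhost {Z : Fin m → Var} {A B : Matrix (Fin m) (Fin m) Term}
    {c : Fin m → Term} (hZ : Ghost (List.ofFn Z) X) (hF : Disjoint (both (List.ofFn Z)) F.fv)
    (hA : ∀ i j, Disjoint (both (List.ofFn Z)) (A i j).fv)
    (hB : ∀ i j, Disjoint (both (List.ofFn Z)) (B i j).fv)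
    (hc : ∀ i, Disjoint (both (List.ofFn Z)) (c i).fv)
    (h : (Form.box (.dap X F) (RA.ne (mdet A) (.const 0)).toForm).sat σ) :
    (Form.alls (List.ofFn Z) (Form.exs (primes (List.ofFn Z)) (.ref X (.dap X F)
      (.dap (X ++ List.ofFn Z) (.and F (RA.vecEq (mulVec A (dvars Z))
        fun i => .add (mulVec B (vars Z) i) (c i))))))).sat σ := by
  refine (Form.sat_alls _ _ _).2 fun ρ hρ => ?_
  let M (τ : State) : Matrix (Fin m) (Fin m) ℝ := (evalMat A τ)⁻¹ * evalMat B τ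
  let d (τ : State) : Fin m → ℝ := (evalMat A τ)⁻¹ *ᵥ fun i => (c i).eval τ
  refine sat_exs_primes_ref (b := M σ *ᵥ (ρ ∘ Z) + d σ) hZ hF hρ fun T f hf => ?_
  have hdet : ∀ t ∈ Icc 0 T, (evalMat A (f t)).det ≠ 0 := by
    simpa [eval_mdet, Term.eval] using sat_box_dap.1 h T f hf
  have hinv : ContinuousOn (fun t => (evalMat A (f t))⁻¹) (Icc 0 T) := fun t ht =>
    tendsto_matrix_inv (((continuous_evalMat A).tendsto _).comp (hf.continuousOn t ht))
      (hdet t ht)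
  have hM : ContinuousOn (fun t => M (f t)) (Icc 0 T) :=
    hinv.mul ((continuous_evalMat B).comp_continuousOn hf.continuousOn)
  have hd : ContinuousOn (fun t => d (f t)) (Icc 0 T) := fun t ht =>
    tendsto_mulVec (hinv t ht) (tendsto_pi_nhds.2 fun i =>
      ((c i).continuous_eval.tendsto _).comp (hf.continuousOn t ht))
  obtain ⟨y, hy0, hy⟩ := exists_hasDerivWithinAt_linear hf.nonneg hM hd (ρ ∘ Z)
  refine ⟨y, fun t => M (f t) *ᵥ y t + d (f t), hy0, by simp only [hf.init, hy0],
    ContinuousOn.add (fun t ht => tendsto_mulVec (hM t ht) (hy t ht).continuousWithinAt) hd,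
    fun t ht => ⟨hy t ht, (RA.sat_vecEq _ _ _).2 fun i => ?_⟩⟩
  have hsolve : evalMat A (f t) *ᵥ (M (f t) *ᵥ y t + d (f t)) =
      evalMat B (f t) *ᵥ y t + fun i => (c i).eval (f t) := by
    simp only [M, d, Matrix.mulVec_add, Matrix.mulVec_mulVec, ← Matrix.mul_assoc,
      Matrix.mul_nonsing_inv _ (hdet t ht).isUnit, Matrix.one_mul, Matrix.one_mulVec]
  simp only [Term.eval, eval_mulVec, dvars, vars, overlay_var hZ.injective, overlay_prime hZ,
    eval_overlay (hA _ _), eval_overlay (hB _ _), eval_overlay (hc _)]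
  exact congrFun hsolve i

theorem sat_differentialCut (h : (Form.box (.dap X F) R.toForm).sat σ) :
    (Form.ref X (.dap X F) (.dap X R)).sat σ := by
  simpa only [sat_box_dap, RA.sat_toForm, sat_ref_dap_self] using h

theorem sat_differentialCut_and (h : (Form.box (.dap X F) R.toForm).sat σ) :
    (Form.ref X (.dap X F) (.dap X (.and F R))).sat σ := by
  rw [sat_box_dap] at h
  exact sat_ref_dap_self.2 fun T f hf t ht => ⟨hf.sat t ht, (R.sat_toForm _).1 (h T f hf t ht)⟩

theorem sat_differentialRefinement (hF : Disjoint (both Z) F.fv) :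
    (Form.ref X (.dap (X ++ Z) (.and R F)) (.dap X F)).sat σ := by
  refine sat_ref_dap.2 fun T f hf => ⟨fun t => (both X).piecewise (f t) σ,
    hf.piecewise (List.subset_append_left X Z) (eqOn_refl _ _) fun t ht => ?_,
    fun t _ v hv => (Finset.piecewise_eq_of_mem _ _ _ hv).symm⟩
  refine (RA.sat_congr fun v hv => ?_).1 (hf.sat t ht).2
  by_cases hX : v ∈ both X
  · simp [hX]
  · have hZ : v ∉ both Z := Finset.disjoint_right.1 hF hv
    simp [hX, hf.const v (by simp [both_append, hX, hZ]) t ht]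

theorem sat_differentialMonotonicity (h : (Form.ref X (.dap X F) (.dap X G)).sat σ) :
    (Form.ref X (.dap X (.and F R)) (.dap X (.and G R))).sat σ := by
  rw [sat_ref_dap_self] at h ⊢
  exact fun T f hf t ht =>
    ⟨h T f (hf.withSat fun s hs => (hf.sat s hs).1) t ht, (hf.sat t ht).2⟩

theorem RA.sat_exs_primes_exs {σ τ : State} (h : ∀ v ∉ both Y, σ v = τ v) (hF : F.sat σ) :
    (exs (primes Y) (exs Y F)).sat τ := by
  refine (sat_exs _ _ _).2 ⟨(primes Y).toFinset.piecewise σ τ, fun v hv => by simp [hv],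
    (sat_exs _ _ _).2 ⟨σ, fun v hv => ?_, hF⟩⟩
  by_cases hp : v ∈ primes Y
  · simp [hp]
  · simpa [hp] using h v (by simp [both, hv, hp])

theorem sat_differentialProjection
    (hF : (Form.box (.dap X (RA.exs (primes Y) (RA.exs Y F))) F.toForm).sat σ)
    (hG : (Form.box (.dap (X ++ Y) (RA.exs (primes Y) (RA.exs Y G))) G.toForm).sat σ)
    (href : (Form.ref X (.dap X F) (.dap X G)).sat σ) :
    (Form.ref (X ++ Y) (.dap (X ++ Y) F) (.dap (X ++ Y) G)).sat σ := by
  simp only [sat_box_dap, RA.sat_toForm, sat_ref_dap_self] at hF hG href ⊢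
  intro T f hf
  have hagree : ∀ t ∈ Icc 0 T, ∀ v ∉ both Y, f t v = (both X).piecewise (f t) σ v := by
    intro t ht v hv
    by_cases hX : v ∈ both X
    · simp [hX]
    · simp [hX, hf.const v (by simp [both_append, hX, hv]) t ht]
  have hproj : IsSolution X (RA.exs (primes Y) (RA.exs Y F)) σ T
      fun t => (both X).piecewise (f t) σ :=
    hf.piecewise (List.subset_append_left X Y) (eqOn_refl _ _) fun t ht =>
      RA.sat_exs_primes_exs (hagree t ht) (hf.sat t ht)
  have hprojG := href T _ (hproj.withSat (hF T _ hproj))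
  exact hG T f (hf.withSat fun t ht =>
    RA.sat_exs_primes_exs (fun v hv => (hagree t ht v hv).symm) (hprojG t ht))

theorem sat_box_mp (hPQ : (Form.box α (P.imp Q)).sat σ) (hP : (Form.box α P).sat σ) :
    (Form.box α Q).sat σ :=
  fun φ hφ => (Form.sat_imp P Q _).1 (hPQ φ hφ) (hP φ hφ)

theorem sat_box_of_disjoint (h : Disjoint P.fv α.bv) (hP : P.sat σ) : (Form.box α P).sat σ :=
  sat_box_iff.2 fun _ hτ =>
    (Form.sat_congr fun _ hv => hτ.eq_of_notMem_bv (Finset.disjoint_left.1 h hv)).2 hP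

theorem sat_box_assign {x : Var} {e : Term} :
    (Form.box (.assign x e) P).sat σ ↔ P.sat (Function.update σ x (e.eval σ)) := by
  simp only [sat_box_iff, reaches_assign, forall_eq]

theorem sat_box_assign_iff_all {x : Var} {e : Term} (h : x ∉ e.fv) :
    (Form.box (.assign x e) P).sat σ ↔ (Form.all x ((RA.eq (.var x) e).toForm.imp P)).sat σ := by
  have he : ∀ r, e.eval (Function.update σ x r) = e.eval σ := fun r =>
    e.eval_congr fun v hv => Function.update_of_ne (ne_of_mem_of_not_mem hv h) _ _
  rw [sat_box_assign]
  simp [Form.sat, RA.sat_toForm, he, Term.eval]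

theorem sat_box_test :
    (Form.box (.test F) P).sat σ ↔ (F.toForm.sat σ → P.sat σ) := by
  simp only [sat_box_iff, reaches_test, RA.sat_toForm, and_imp, forall_eq_apply_imp_iff]

theorem sat_box_choice :
    (Form.box (.choice α β) P).sat σ ↔ (Form.and (.box α P) (.box β P)).sat σ := by
  simp only [Form.sat_and, sat_box_iff, reaches_choice, or_imp, forall_and]

theorem sat_box_seq : (Form.box (.seq α β) P).sat σ ↔ (Form.box α (.box β P)).sat σ := by
  simp only [sat_box_iff, reaches_seq]
  grind

theorem sat_box_loop :
    (Form.box (.loop α) P).sat σ ↔ (Form.and P (.box α (.box (.loop α) P))).sat σ := by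
  simp only [Form.sat_and, sat_box_iff, reaches_loop]
  refine ⟨fun h => ⟨h σ .refl, fun ρ hρ τ hτ => h τ (.head hρ hτ)⟩, fun ⟨hP, h⟩ τ hτ => ?_⟩
  rcases hτ.cases_head with rfl | ⟨ρ, hρ, hτ⟩
  · exact hP
  · exact h ρ hρ τ hτ

theorem sat_box_loop_induction :
    (Form.box (.loop α) P).sat σ ↔ (Form.and P (.box (.loop α) (P.imp (.box α P)))).sat σ := by
  simp only [Form.sat_and, Form.sat_imp, sat_box_iff, reaches_loop]
  refine ⟨fun h => ⟨h σ .refl, fun ρ hρ _ τ hτ => h τ (hρ.tail hτ)⟩, fun ⟨hP, h⟩ τ hτ => ?_⟩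
  induction hτ with
  | refl => exact hP
  | tail hρ hτ ih => exact h _ hρ ih _ hτ

theorem Ax.valid (h : Ax P) : P.Valid := by
  intro σ
  cases h with
  | diffVar x => simpa using Term.eval_diff_var σ x
  | diffConst c => simpa using Term.eval_diff_const σ c
  | diffAdd e g => simpa using Term.eval_diff_add e g σ
  | diffMul e g => simpa using Term.eval_diff_mul e g σ
  | jacobian X Y e hX hop he => simpa using sat_jacobian hX hop he
  | refBox X α β P h => simpa using sat_box_of_sat_ref h
  | refTrans X α β γ => simpa using sat_ref_trans
  | dW X F => exact sat_box_dap.2 fun T f hf t ht => (F.sat_toForm _).2 (hf.sat t ht)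
  | dIle X Y e he => simpa using sat_differentialInduction_le he
  | dIlt X Y e he => simpa using sat_differentialInduction_lt he
  | dHC X Y e he => simpa using sat_differentialHiddenConstraint he
  | aG X Z F e g hop hZ hF hg => simpa using sat_algebraicGhost hop hZ hF hg
  | dG X Z F A B c hZ hF hA hB hc => simpa using sat_differentialGhost hZ hF hA hB hc
  | dC X F R => simpa using sat_differentialCut
  | dCand X F R => simpa using sat_differentialCut_and
  | dR X Z F R hF => simp [Form.sat_alls, sat_differentialRefinement hF]
  | dM X F G R => simpa using sat_differentialMonotonicity
  | dP X Y F G => simpa using sat_differentialProjection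
  | boxK α P Q => simpa using sat_box_mp
  | boxV α P h => simpa using sat_box_of_disjoint h
  | boxAssign x e P h => simpa using sat_box_assign_iff_all h
  | boxTest F P => simpa using sat_box_test
  | boxChoice α β P => simpa using sat_box_choice
  | boxSeq α β P => simpa using sat_box_seq
  | boxLoop α P => simpa using sat_box_loop
  | boxInd α P => simpa using sat_box_loop_induction
  | allElim x P => exact (Form.sat_imp _ _ σ).2 fun h => by simpa using h (σ x)
  | allInst x e P => exact (Form.sat_imp _ _ σ).2 fun h => sat_box_assign.2 (h _)
  | eqRefl e => simp
  | leCongr e e₁ g g₁ => simp +contextual [Form.sat]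
  | addCongr e e₁ g g₁ => simp +contextual [Term.eval]
  | mulCongr e e₁ g g₁ => simp +contextual [Term.eval]

/-! ### Soundness of the rules -/

theorem Sequent.Valid.allR {x : Var} {Γ Δ : List Form} (h : Sequent.Valid ⟨Γ, P :: Δ⟩)
    (hΓ : ∀ Q ∈ Γ, x ∉ Q.fv) (hΔ : ∀ Q ∈ Δ, x ∉ Q.fv) : Sequent.Valid ⟨Γ, .all x P :: Δ⟩ := by
  intro σ hσ
  have hupdate : ∀ (r : ℝ) (Q : Form), x ∉ Q.fv → (Q.sat (Function.update σ x r) ↔ Q.sat σ) :=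
    fun r Q hQ => Form.sat_congr fun v hv =>
      Function.update_of_ne (ne_of_mem_of_not_mem hv hQ) _ _
  by_cases hall : ∀ r : ℝ, P.sat (Function.update σ x r)
  · exact ⟨_, List.mem_cons_self, hall⟩
  · push Not at hall
    obtain ⟨r, hr⟩ := hall
    obtain ⟨Q, hQ, hs⟩ := h (Function.update σ x r) fun Q hQ =>
      (hupdate r Q (hΓ Q hQ)).2 (hσ Q hQ)
    rcases List.mem_cons.1 hQ with rfl | hQ
    · exact absurd hs hr
    · exact ⟨Q, List.mem_cons_of_mem _ hQ, (hupdate r Q (hΔ Q hQ)).1 hs⟩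

theorem Rule.sound {ps : List Sequent} {s : Sequent} (h : Rule ps s)
    (hps : ∀ p ∈ ps, p.Valid) : s.Valid := by
  cases h with
  | ax P h Γ Δ => exact fun σ _ => ⟨P, List.mem_cons_self, h.valid σ⟩
  | real F hop h Γ Δ =>
    exact fun σ _ => ⟨F.toForm, List.mem_cons_self, (F.sat_toForm σ).2 (h σ)⟩
  | gen α P Γ Δ =>
    have hP : P.Valid := by simpa [Sequent.Valid, Form.Valid] using hps
    exact fun σ _ => ⟨_, List.mem_cons_self, fun φ _ => hP φ.final⟩
  | id P Γ Δ => exact fun σ h => ⟨P, List.mem_cons_self, h P List.mem_cons_self⟩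
  | weaken Γ Δ Γ₁ Δ₁ hΓ hΔ =>
    intro σ h
    obtain ⟨P, hP, hs⟩ := hps _ List.mem_cons_self σ fun P hP => h P (hΓ hP)
    exact ⟨P, hΔ hP, hs⟩
  | allR x P Γ Δ hΓ hΔ => exact (hps _ List.mem_cons_self).allR hΓ hΔ
  | negL P Γ Δ | negR P Γ Δ | andL P Q Γ Δ =>
    intro σ
    simp only [Sequent.Valid, List.forall_mem_cons, List.exists_mem_cons_iff, Form.sat] at hps ⊢
    have hprem := hps.1 σ
    tauto
  | cut P Γ Δ | andR P Q Γ Δ =>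
    intro σ
    simp only [Sequent.Valid, List.forall_mem_cons, List.exists_mem_cons_iff, Form.sat] at hps ⊢
    have hprem₁ := hps.1 σ
    have hprem₂ := hps.2.1 σ
    tauto

theorem Provable.valid {s : Sequent} (h : Provable s) : s.Valid := by
  induction h with
  | step ps s h _ ih => exact h.sound ih

end

end DAL

theorem theorem1 :
    (∀ P : DAL.Form, DAL.Ax P → P.Valid) ∧
    (∀ (ps : List DAL.Sequent) (s : DAL.Sequent), DAL.Rule ps s →
      (∀ p ∈ ps, p.Valid) → s.Valid) ∧
    (∀ s : DAL.Sequent, DAL.Provable s → s.Valid) :=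
  ⟨fun _ h => h.valid, fun _ _ h hps => h.sound hps, fun _ h => h.valid⟩
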